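/- Let $X$ be an analytically finite Riemann surface, i.e. a (connected) Riemann surface biholomorphic to $S\setminus P$ for a compact connected Riemann surface $S$ and a finite, possibly empty, set $P\subset S$. Let $A^2(X)$ be the space of holomorphic quadratic differentials $\varphi=\varphi(z)\,dz^2$ on $X$ with $\|\varphi\|_1=\int_X|\varphi(z)|\,dx\,dy<\infty$, and let $L^\infty(X)$ be the space of Beltrami differentials, i.e. measurable, essentially bounded $(-1,1)$-forms $\mu=\mu(z)\,d\bar z/dz$, up to equality almost everywhere, with $\|\mu\|_\infty=\operatorname{ess\,sup}_X|\mu|$. For $\mu\in L^\infty(X)$ and $\varphi_0\in A^2(X)$ put $$\beta(\mu,\varphi_0)=\sup\Big\{\Big|\int_X\mu\varphi\Big|+\operatorname{Re}\int_X\mu\varphi_0 \;\Big|\; \varphi\in A^2(X),\ \|\varphi\|_1=1\Big\},$$ the supremum being taken in $[-\infty,\infty]$ (so that it is $-\infty$ if $A^2(X)=\{0\}$), and call $\mu$ infinitesimally $\varphi_0$-extremal if $$\beta(\mu,\varphi_0)=\|\mu\|_\infty+\operatorname{Re}\int_X\mu\varphi_0 .$$ Then, for every $\varphi_0\in A^2(X)$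 and every $\mu\in L^\infty(X)$, the following two conditions are equivalent: (a) $\mu$ is infinitesimally $\varphi_0$-extremal; (b) $\mu$ is a Teichmüller Beltrami differential, i.e. there are $\psi\in A^2(X)\setminus\{0\}$ and $c\ge 0$ such that $\mu=c\,\overline{\psi}/|\psi|$ (almost everywhere). -/

import Mathlib

open scoped Manifold ContDiff ENNReal
open MeasureTheory Set

universe u

noncomputable section

namespace Riemann

section Forms

variable (X : Type u) [TopologicalSpace X] [ChartedSpace ℂ X]

/-- The charts of the given (holomorphic) atlas of `X`, that is, the local coordinates `z`. -/
abbrev Chart : Type u := atlas ℂ X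

variable {X}

/-- The coordinate change `w = trans e e' z` from the coordinate `z = e` to the coordinate
`w = e'`. -/
def trans (e e' : Chart X) (z : ℂ) : ℂ := e'.1 (e.1.symm z)

/-- The points of the coordinate domain of `e` at which the coordinate `e'` is defined too. -/
def overlap (e e' : Chart X) : Set ℂ := {z | z ∈ e.1.target ∧ e.1.symm z ∈ e'.1.source}

variable (X)

/-- A holomorphic quadratic differential `φ = φ(z) dz²`: a holomorphic function in every local
coordinate, with `φ(z) dz² = φ(w) dw²` on overlaps. Values outside `e.target` are irrelevant. -/
structure HolomorphicQuadraticDifferential where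
  coeff : Chart X → ℂ → ℂ
  holomorphic : ∀ e, DifferentiableOn ℂ (coeff e) e.1.target
  transform : ∀ e e', ∀ z ∈ overlap e e',
    coeff e z = coeff e' (trans e e' z) * deriv (trans e e') z ^ 2

/-- A Beltrami differential (an element of `L^∞(X)`): a measurable, essentially bounded
`(-1,1)`-form `μ = μ(z) dz̄/dz`, with `μ(z) dz̄/dz = μ(w) dw̄/dw` on overlaps.
As usual it is given by a representative; equality in `L^∞(X)` means equality almost everywhere.
Values outside `e.target` are irrelevant. -/
structure BeltramiDifferential where
  coeff : Chart X → ℂ → ℂ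
  measurable : ∀ e, AEMeasurable (coeff e) (volume.restrict e.1.target)
  transform : ∀ e e', ∀ z ∈ overlap e e',
    coeff e z = coeff e' (trans e e' z) *
      (starRingEnd ℂ (deriv (trans e e') z) / deriv (trans e e') z)
  bounded : ∃ C : ℝ, ∀ e, ∀ᵐ z ∂(volume.restrict e.1.target), ‖coeff e z‖ ≤ C

/-- A sequence of charts that cover `X`. -/
structure ChartCover where
  chart : ℕ → Chart X
  cover : ∀ x : X, ∃ n, x ∈ (chart n).1.source

end Forms

section Integration

variable {X : Type u} [TopologicalSpace X] [ChartedSpace ℂ X]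

/-- The part of the `n`-th chart domain that the earlier charts do not cover. The pieces
form a countable partition of `X` into Borel sets, each contained in a chart domain. -/
def ChartCover.piece (C : ChartCover X) (n : ℕ) : Set X :=
  (C.chart n).1.source \ ⋃ k < n, (C.chart k).1.source

/-- `∫_X ρ(z) dx dy` for a nonnegative area density `ρ(z) dx dy`, computed along a chart cover. -/
def ChartCover.lintegral (C : ChartCover X) (ρ : Chart X → ℂ → ℝ≥0∞) : ℝ≥0∞ :=
  ∑' n, ∫⁻ z in (C.chart n).1 '' C.piece n, ρ (C.chart n) z

/-- `∫_X f(z) dx dy` for a complex area density `f(z) dx dy`, computed along a chart cover. -/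
def ChartCover.integral (C : ChartCover X) (f : Chart X → ℂ → ℂ) : ℂ :=
  ∑' n, ∫ z in (C.chart n).1 '' C.piece n, f (C.chart n) z

/-- A second countable space is covered by a sequence of charts. -/
theorem ChartCover.nonempty [SecondCountableTopology X] [Nonempty X] :
    Nonempty (ChartCover X) := by
  obtain ⟨s, hs, hcov⟩ := TopologicalSpace.countable_cover_nhds
    (f := fun x : X => (chartAt ℂ x).source) (fun x => chart_source_mem_nhds ℂ x)
  have hne : s.Nonempty := by
    rw [Set.nonempty_iff_ne_empty]
    rintro rfl
    exact Set.empty_ne_univ (by simpa using hcov)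
  obtain ⟨g, rfl⟩ := hs.exists_eq_range hne
  refine ⟨⟨fun n => ⟨chartAt ℂ (g n), chart_mem_atlas ℂ (g n)⟩, fun x => ?_⟩⟩
  have hx : x ∈ ⋃ y ∈ range g, (chartAt ℂ y).source := by rw [hcov]; trivial
  simpa using hx

/-- Coordinate changes are holomorphic. -/
theorem differentiableAt_trans [IsManifold 𝓘(ℂ) ω X] {e e' : Chart X} {z : ℂ}
    (hz : z ∈ overlap e e') : DifferentiableAt ℂ (trans e e') z := by
  have h := (contDiffGroupoid ω 𝓘(ℂ)).compatible e.2 e'.2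
  have h1 := (contMDiffOn_of_mem_contDiffGroupoid h).contDiffOn
  have hs : z ∈ (e.1.symm ≫ₕ e'.1).source := by
    rw [OpenPartialHomeomorph.trans_source]
    exact hz
  exact (h1.differentiableOn (by simp) z hs).differentiableAt
    ((e.1.symm ≫ₕ e'.1).open_source.mem_nhds hs)

theorem image_trans {e e' : Chart X} {A : Set X} (hA : A ⊆ e.1.source) :
    trans e e' '' (e.1 '' A) = e'.1 '' A := by
  rw [Set.image_image]
  refine Set.image_congr fun x hx => ?_
  simp only [trans]
  rw [e.1.left_inv (hA hx)]

theorem image_subset_overlap {e e' : Chart X} {A : Set X} (hA : A ⊆ e.1.source)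
    (hA' : A ⊆ e'.1.source) : e.1 '' A ⊆ overlap e e' := by
  rintro _ ⟨x, hx, rfl⟩
  refine ⟨e.1.map_source (hA hx), ?_⟩
  rw [e.1.left_inv (hA hx)]
  exact hA' hx

theorem injOn_trans (e e' : Chart X) : InjOn (trans e e') (overlap e e') := by
  rintro z hz w hw h
  have h1 := e'.1.injOn hz.2 hw.2 h
  exact e.1.symm.injOn hz.1 hw.1 h1

theorem ChartCover.piece_subset (C : ChartCover X) (n : ℕ) :
    C.piece n ⊆ (C.chart n).1.source := fun _ hx => hx.1

/-- Images of Borel pieces under charts are Borel. -/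
theorem ChartCover.measurableSet_image (C D : ChartCover X) (e : Chart X) (n m : ℕ)
    (he : C.piece n ∩ D.piece m ⊆ e.1.source) :
    MeasurableSet (e.1 '' (C.piece n ∩ D.piece m)) := by
  have hO : ∀ O : Set X, IsOpen O → IsOpen (e.1 '' (e.1.source ∩ O)) := fun O hO =>
    e.1.isOpen_image_of_subset_source (e.1.open_source.inter hO) inter_subset_left
  set U : Set X := (C.chart n).1.source ∩ (D.chart m).1.source with hU
  set V : Set X := (⋃ k < n, (C.chart k).1.source) ∪ ⋃ k < m, (D.chart k).1.source with hV
  have hUo : IsOpen U := (C.chart n).1.open_source.inter (D.chart m).1.open_source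
  have hVo : IsOpen V := (isOpen_biUnion fun k _ => (C.chart k).1.open_source).union
    (isOpen_biUnion fun k _ => (D.chart k).1.open_source)
  have hset : C.piece n ∩ D.piece m = (e.1.source ∩ U) \ V := by
    ext x
    constructor
    · intro hx
      exact ⟨⟨he hx, hx.1.1, hx.2.1⟩, fun h => h.elim hx.1.2 hx.2.2⟩
    · rintro ⟨⟨h0, h1, h2⟩, h3⟩
      exact ⟨⟨h1, fun h => h3 (Or.inl h)⟩, ⟨h2, fun h => h3 (Or.inr h)⟩⟩
  rw [hset, (e.1.injOn.mono inter_subset_left : InjOn e.1 (e.1.source ∩ U)).image_sdiff,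
    inter_assoc]
  exact (hO U hUo).measurableSet.diff (hO _ (hUo.inter hVo)).measurableSet

theorem ChartCover.iUnion_piece (C : ChartCover X) : ⋃ n, C.piece n = univ := by
  classical
  refine eq_univ_of_forall fun x => mem_iUnion.2 ⟨Nat.find (C.cover x), ?_, ?_⟩
  · exact Nat.find_spec (C.cover x)
  · simp only [mem_iUnion, not_exists]
    exact fun k hk => Nat.find_min (C.cover x) hk

theorem ChartCover.disjoint_piece (C : ChartCover X) :
    Pairwise (Function.onFun Disjoint C.piece) := by
  have key : ∀ n m, n < m → Disjoint (C.piece n) (C.piece m) := fun n m h =>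
    Set.disjoint_left.2 fun x hx hx' => hx'.2 (mem_biUnion h hx.1)
  intro n m h
  rcases lt_or_gt_of_ne h with h | h
  · exact key n m h
  · exact (key m n h).symm

theorem ChartCover.image_piece_eq (C D : ChartCover X) (n : ℕ) :
    (C.chart n).1 '' C.piece n = ⋃ m, (C.chart n).1 '' (C.piece n ∩ D.piece m) := by
  rw [← image_iUnion, ← inter_iUnion, D.iUnion_piece, inter_univ]

theorem ChartCover.disjoint_image (C D : ChartCover X) (n : ℕ) :
    Pairwise (Function.onFun Disjoint fun m => (C.chart n).1 '' (C.piece n ∩ D.piece m)) := by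
  intro m m' h
  refine Set.disjoint_left.2 ?_
  rintro _ ⟨x, hx, rfl⟩ ⟨y, hy, hxy⟩
  have : y = x := (C.chart n).1.injOn hy.1.1 hx.1.1 hxy
  subst this
  exact Set.disjoint_left.1 (D.disjoint_piece h) hx.2 hy.2

theorem det_trans (a : ℂ) :
    |((ContinuousLinearMap.toSpanSingleton ℂ a).restrictScalars ℝ).det| = ‖a‖ ^ 2 := by
  simp [ContinuousLinearMap.det, LinearMap.det_restrictScalars, Algebra.norm_complex_eq,
    Complex.normSq_eq_norm_sq]

/-- The integral of a nonnegative density does not depend on the chart cover. -/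
theorem ChartCover.lintegral_eq [IsManifold 𝓘(ℂ) ω X] (C D : ChartCover X)
    (ρ : Chart X → ℂ → ℝ≥0∞)
    (hρ : ∀ e e', ∀ z ∈ overlap e e',
      ρ e z = ρ e' (trans e e' z) * ENNReal.ofReal (‖deriv (trans e e') z‖ ^ 2)) :
    C.lintegral ρ = D.lintegral ρ := by
  have hC : ∀ C D : ChartCover X, C.lintegral ρ =
      ∑' n, ∑' m, ∫⁻ z in (C.chart n).1 '' (C.piece n ∩ D.piece m), ρ (C.chart n) z := by
    intro C D
    refine tsum_congr fun n => ?_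
    rw [C.image_piece_eq D n, lintegral_iUnion
      (fun m => C.measurableSet_image D _ n m fun x hx => hx.1.1) (C.disjoint_image D n)]
  rw [hC C D, hC D C, ENNReal.tsum_comm]
  refine tsum_congr fun m => tsum_congr fun n => ?_
  have h1 : C.piece n ∩ D.piece m ⊆ (C.chart n).1.source := fun x hx => hx.1.1
  have h2 : C.piece n ∩ D.piece m ⊆ (D.chart m).1.source := fun x hx => hx.2.1
  have hsub := image_subset_overlap h1 h2
  have hms := C.measurableSet_image D _ n m h1
  rw [inter_comm (D.piece m), ← image_trans (e' := D.chart m) h1,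
    lintegral_image_eq_lintegral_abs_det_fderiv_mul volume hms
      (fun z hz => ((differentiableAt_trans (hsub hz)).hasDerivAt.hasFDerivAt.restrictScalars
        ℝ).hasFDerivWithinAt) ((injOn_trans _ _).mono hsub)]
  refine setLIntegral_congr_fun hms fun z hz => ?_
  simp only [det_trans]
  rw [hρ _ _ z (hsub hz), mul_comm]

/-- The integral of an integrable complex density does not depend on the chart cover. -/
theorem ChartCover.integral_eq [IsManifold 𝓘(ℂ) ω X] (C D : ChartCover X)
    (f : Chart X → ℂ → ℂ)
    (hf : ∀ e e', ∀ z ∈ overlap e e',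
      f e z = f e' (trans e e' z) * (‖deriv (trans e e') z‖ ^ 2 : ℝ))
    (hm : ∀ e, AEMeasurable (f e) (volume.restrict e.1.target))
    (hfin : C.lintegral (fun e z => ‖f e z‖ₑ) < ⊤) :
    C.integral f = D.integral f := by
  have hlin := C.lintegral_eq D (fun e z => ‖f e z‖ₑ) (by
    intro e e' z hz
    rw [hf e e' z hz, enorm_mul, ← ofReal_norm (E := ℂ) ((‖deriv (trans e e') z‖ ^ 2 : ℝ) : ℂ)]
    simp)
  have hint : ∀ C : ChartCover X, C.lintegral (fun e z => ‖f e z‖ₑ) < ⊤ →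
      ∀ n, IntegrableOn (f (C.chart n)) ((C.chart n).1 '' C.piece n) := by
    intro C hC n
    refine ⟨((hm (C.chart n)).mono_measure (Measure.restrict_mono ?_ le_rfl)).aestronglyMeasurable,
      (ENNReal.le_tsum n).trans_lt hC⟩
    rintro _ ⟨x, hx, rfl⟩
    exact (C.chart n).1.map_source hx.1
  have hC : ∀ C D : ChartCover X, C.lintegral (fun e z => ‖f e z‖ₑ) < ⊤ → C.integral f =
      ∑' n, ∑' m, ∫ z in (C.chart n).1 '' (C.piece n ∩ D.piece m), f (C.chart n) z := by
    intro C D hC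
    refine tsum_congr fun n => ?_
    have h := hint C hC n
    rw [C.image_piece_eq D n] at h ⊢
    rw [(hasSum_integral_iUnion
      (fun m => C.measurableSet_image D _ n m fun x hx => hx.1.1) (C.disjoint_image D n)
      h).tsum_eq]
  have hsum : Summable (Function.uncurry fun n m =>
      ∫ z in (C.chart n).1 '' (C.piece n ∩ D.piece m), f (C.chart n) z) := by
    refine Summable.of_enorm (ne_top_of_le_ne_top hfin.ne ?_)
    rw [ENNReal.tsum_prod']
    refine ENNReal.tsum_le_tsum fun n => ?_
    rw [C.image_piece_eq D n, lintegral_iUnion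
      (fun m => C.measurableSet_image D _ n m fun x hx => hx.1.1) (C.disjoint_image D n)]
    exact ENNReal.tsum_le_tsum fun m => enorm_integral_le_lintegral_enorm _
  rw [hC C D hfin, hC D C (hlin ▸ hfin), ← hsum.tsum_comm]
  refine tsum_congr fun m => tsum_congr fun n => ?_
  have h1 : C.piece n ∩ D.piece m ⊆ (C.chart n).1.source := fun x hx => hx.1.1
  have h2 : C.piece n ∩ D.piece m ⊆ (D.chart m).1.source := fun x hx => hx.2.1
  have hsub := image_subset_overlap h1 h2
  have hms := C.measurableSet_image D _ n m h1
  rw [inter_comm (D.piece m), ← image_trans (e' := D.chart m) h1,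
    integral_image_eq_integral_abs_det_fderiv_smul volume hms
      (fun z hz => ((differentiableAt_trans (hsub hz)).hasDerivAt.hasFDerivAt.restrictScalars
        ℝ).hasFDerivWithinAt) ((injOn_trans _ _).mono hsub)]
  refine setIntegral_congr_fun hms fun z hz => ?_
  simp only [det_trans]
  rw [hf _ _ z (hsub hz), mul_comm, Complex.real_smul]

/-- The integral `∫_X ρ` of a nonnegative area density; the chart cover is immaterial. -/
def surfaceLIntegral [SecondCountableTopology X] [Nonempty X]
    (ρ : Chart X → ℂ → ℝ≥0∞) : ℝ≥0∞ :=
  (Classical.choice (ChartCover.nonempty (X := X))).lintegral ρ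

/-- The integral `∫_X f` of a complex area density; the chart cover is immaterial. -/
def surfaceIntegral [SecondCountableTopology X] [Nonempty X]
    (f : Chart X → ℂ → ℂ) : ℂ :=
  (Classical.choice (ChartCover.nonempty (X := X))).integral f

end Integration

section Extremality

variable {X : Type u} [TopologicalSpace X] [ChartedSpace ℂ X]

/-- `‖μ‖_∞ = ess sup |μ|`. -/
def BeltramiDifferential.linftyNorm (μ : BeltramiDifferential X) : ℝ≥0∞ :=
  ⨆ e : Chart X, essSup (fun z => ‖μ.coeff e z‖ₑ) (volume.restrict e.1.target)

/-- `φ ≠ 0`, that is, `φ` does not vanish identically. -/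
def HolomorphicQuadraticDifferential.Nonzero (φ : HolomorphicQuadraticDifferential X) : Prop :=
  ∃ e : Chart X, ∃ z ∈ e.1.target, φ.coeff e z ≠ 0

/-- `μ` is the Teichmüller differential `c ψ̄/|ψ|`, as an identity in `L^∞(X)`. -/
def BeltramiDifferential.EqTeichmuller (μ : BeltramiDifferential X) (c : ℝ)
    (ψ : HolomorphicQuadraticDifferential X) : Prop :=
  ∀ e : Chart X, ∀ᵐ z ∂(volume.restrict e.1.target),
    μ.coeff e z = c * (starRingEnd ℂ (ψ.coeff e z) / ‖ψ.coeff e z‖)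

variable [SecondCountableTopology X] [Nonempty X]

/-- `‖φ‖₁ = ∫_X |φ(z)| dx dy`. -/
def HolomorphicQuadraticDifferential.l1Norm (φ : HolomorphicQuadraticDifferential X) : ℝ≥0∞ :=
  surfaceLIntegral fun e z => ‖φ.coeff e z‖ₑ

variable (X) in
/-- The space `A²(X)` of integrable holomorphic quadratic differentials. -/
def A2 : Set (HolomorphicQuadraticDifferential X) := {φ | φ.l1Norm < ⊤}

/-- The pairing `∫_X μ φ`. -/
def pairing (μ : BeltramiDifferential X) (φ : HolomorphicQuadraticDifferential X) : ℂ :=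
  surfaceIntegral fun e z => μ.coeff e z * φ.coeff e z

/-- `β(μ, φ₀) = sup {|∫_X μ φ| + Re ∫_X μ φ₀ : φ ∈ A²(X), ‖φ‖₁ = 1}`, a supremum in `[-∞, ∞]`
(so it is `-∞` if `A²(X) = 0`). -/
def beta (μ : BeltramiDifferential X) (φ₀ : HolomorphicQuadraticDifferential X) : EReal :=
  sSup {t | ∃ φ ∈ A2 X, φ.l1Norm = 1 ∧ t = ((‖pairing μ φ‖ + (pairing μ φ₀).re : ℝ) : EReal)}

/-- `μ` is infinitesimally `φ₀`-extremal: `β(μ, φ₀) = ‖μ‖_∞ + Re ∫_X μ φ₀`. -/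
def InfinitesimallyExtremal (φ₀ : HolomorphicQuadraticDifferential X)
    (μ : BeltramiDifferential X) : Prop :=
  beta μ φ₀ = ((μ.linftyNorm.toReal + (pairing μ φ₀).re : ℝ) : EReal)

/-- `‖φ‖₁` may be computed along any chart cover. -/
theorem l1Norm_eq [IsManifold 𝓘(ℂ) ω X] (φ : HolomorphicQuadraticDifferential X)
    (C : ChartCover X) : φ.l1Norm = C.lintegral fun e z => ‖φ.coeff e z‖ₑ := by
  refine (Classical.choice (ChartCover.nonempty (X := X))).lintegral_eq C
    (fun e z => ‖φ.coeff e z‖ₑ) fun e e' z hz => ?_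
  rw [φ.transform e e' z hz, enorm_mul, enorm_pow, ENNReal.ofReal_pow (norm_nonneg _), ofReal_norm]

/-- `∫_X μ φ` with `φ ∈ A²(X)` may be computed along any chart cover. -/
theorem pairing_eq [IsManifold 𝓘(ℂ) ω X] (μ : BeltramiDifferential X)
    (φ : HolomorphicQuadraticDifferential X) (hφ : φ ∈ A2 X) (C : ChartCover X) :
    pairing μ φ = C.integral fun e z => μ.coeff e z * φ.coeff e z := by
  refine (Classical.choice (ChartCover.nonempty (X := X))).integral_eq C
    (fun e z => μ.coeff e z * φ.coeff e z) (fun e e' z hz => ?_) (fun e => ?_) ?_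
  · rw [φ.transform e e' z hz, μ.transform e e' z hz]
    by_cases h : deriv (trans e e') z = 0
    · simp [h]
    · have h2 : ((‖deriv (trans e e') z‖ ^ 2 : ℝ) : ℂ) =
          deriv (trans e e') z * starRingEnd ℂ (deriv (trans e e') z) := by
        rw [Complex.mul_conj, Complex.normSq_eq_norm_sq]
      rw [h2]
      field_simp
  · exact (μ.measurable e).mul
      ((φ.holomorphic e).continuousOn.aemeasurable e.1.open_target.measurableSet)
  · obtain ⟨K, hK⟩ := μ.bounded
    refine lt_of_le_of_lt (b := ENNReal.ofReal K * φ.l1Norm) ?_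
      (ENNReal.mul_lt_top ENNReal.ofReal_lt_top hφ)
    rw [HolomorphicQuadraticDifferential.l1Norm, surfaceLIntegral, ChartCover.lintegral,
      ChartCover.lintegral, ← ENNReal.tsum_mul_left]
    refine ENNReal.tsum_le_tsum fun n => ?_
    rw [← lintegral_const_mul' _ _ ENNReal.ofReal_ne_top]
    refine lintegral_mono_ae ?_
    have hsub : ∀ (C : ChartCover X) n, (C.chart n).1 '' C.piece n ⊆ (C.chart n).1.target := by
      rintro C n _ ⟨x, hx, rfl⟩
      exact (C.chart n).1.map_source hx.1
    filter_upwards [ae_restrict_of_ae_restrict_of_subset (hsub _ n) (hK _)] with z hz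
    rw [enorm_mul]
    gcongr
    rw [← ofReal_norm]
    exact ENNReal.ofReal_le_ofReal hz

end Extremality

/-- `X` is analytically finite: it is biholomorphic to the complement of a finite set in a
compact connected Riemann surface `S`. (A holomorphic open embedding is biholomorphic onto its
image.) -/
def AnalyticallyFinite (X : Type u) [TopologicalSpace X] [ChartedSpace ℂ X] : Prop :=
  ∃ (S : Type u) (_ : TopologicalSpace S) (_ : ChartedSpace ℂ S),
    IsManifold 𝓘(ℂ) ω S ∧ T2Space S ∧ CompactSpace S ∧ ConnectedSpace S ∧
      ∃ ι : X → S, MDifferentiable 𝓘(ℂ) 𝓘(ℂ) ι ∧ Topology.IsOpenEmbedding ι ∧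
        (range ι)ᶜ.Finite

end Riemann

end

open Riemann

noncomputable section

open Filter Topology Metric

namespace Riemann

/-! ### Holomorphic functions on plane discs: mean values, normal families, simple poles -/

section ComplexAnalysis

/-! The term `Re ∫ μφ₀` is a fixed real number that occurs on both sides of the extremality equation
and cancels. What remains is the Hamilton–Krushkal condition: the functional `φ ↦ ∫ μφ` on `A²(X)`
has norm `‖μ‖_∞`. If `A²(X) = 0`, both conditions fail: `β = -∞`, and there is no nonzero `ψ`.

If `μ = c ψ̄/|ψ|`, then `∫ μψ = c ‖ψ‖₁` and `‖μ‖_∞ = c`, so the normalized `ψ` attains the trivial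
upper bound `|∫ μφ| ≤ ‖μ‖_∞ ‖φ‖₁`.

Conversely, the supremum is attained because the unit ball of `A²(X)` is compact in norm
(`AnalyticallyFinite.exists_tendsto_l1Norm_sub`). A maximizer, rotated so that `∫ μψ = ‖μ‖_∞`, gives
equality in `Re(μψ) ≤ ‖μ‖_∞ |ψ|` almost everywhere. Since `ψ` vanishes only at isolated points, one
may divide by it (`BeltramiDifferential.eqTeichmuller_of_pairing_eq`).

Compactness is where analytic finiteness enters. The mean value inequality bounds unit-norm
differentials locally, so they form a normal family. The compact surface `S` is covered by finitely
many discs, so mass could be lost only at their centers, the possible punctures. There an integrable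
`φ` has at most a simple pole, with `(z - c)φ` bounded uniformly in `φ`
(`exists_differentiableOn_eq_sub_mul`). As `1/|z - c|` is integrable in the plane, locally uniform
convergence becomes convergence in `L¹`. The discs come from charts of `S` that need not lie in the
given atlas of `X`, so this argument runs on the maximal atlas, where `‖φ‖₁` is the same. -/

theorem lintegral_eq_lintegral_circleMap {g : ℂ → ℝ≥0∞} (hg : Measurable g) (c : ℂ) :
    ∫⁻ z, g z = ∫⁻ s in Ioi (0 : ℝ), ENNReal.ofReal s *
      ∫⁻ θ in Ioo (-Real.pi) Real.pi, g (circleMap c s θ) := by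
  have hsymm : ∀ p : ℝ × ℝ, Complex.polarCoord.symm p + c = circleMap c p.1 p.2 := by
    intro p
    rw [Complex.polarCoord_symm_apply, circleMap, Complex.exp_mul_I]
    push_cast
    ring
  have hcm : Measurable fun p : ℝ × ℝ => circleMap c p.1 p.2 := by
    unfold circleMap
    fun_prop
  rw [← lintegral_add_right_eq_self g c,
    ← Complex.lintegral_comp_polarCoord_symm fun z => g (z + c),
    show polarCoord.target = Ioi (0 : ℝ) ×ˢ Ioo (-Real.pi) Real.pi from rfl]
  simp only [hsymm, smul_eq_mul]
  rw [Measure.volume_eq_prod, setLIntegral_prod _ (by fun_prop)]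
  refine lintegral_congr fun s => ?_
  exact lintegral_const_mul' _ _ ENNReal.ofReal_ne_top

theorem circleMap_mem_ball_iff {c : ℂ} {r s θ : ℝ} (hs : 0 < s) :
    circleMap c s θ ∈ ball c r ↔ s < r := by
  simp [circleMap, abs_of_pos hs]

/-- Measurability is asked of the extension by zero, since the mean value inequality concerns
functions that are holomorphic on the disc only. -/
theorem setLIntegral_ball_eq {f : ℂ → ℝ≥0∞} {c : ℂ} {r : ℝ}
    (hf : Measurable ((ball c r).indicator f)) :
    ∫⁻ z in ball c r, f z = ∫⁻ s in Ioo 0 r, ENNReal.ofReal s *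
      ∫⁻ θ in Ioo (-Real.pi) Real.pi, f (circleMap c s θ) := by
  rw [← lintegral_indicator measurableSet_ball, lintegral_eq_lintegral_circleMap hf c,
    ← lintegral_indicator measurableSet_Ioi, ← lintegral_indicator measurableSet_Ioo]
  refine lintegral_congr fun s => ?_
  by_cases hs : 0 < s
  · by_cases hr : s < r
    · rw [indicator_of_mem (show s ∈ Ioi (0 : ℝ) from hs),
        indicator_of_mem (show s ∈ Ioo 0 r from ⟨hs, hr⟩)]
      congr 1
      refine lintegral_congr fun θ => ?_
      rw [indicator_of_mem ((circleMap_mem_ball_iff hs).2 hr)]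
    · rw [indicator_of_mem (show s ∈ Ioi (0 : ℝ) from hs),
        indicator_of_notMem (show s ∉ Ioo 0 r from fun h => hr h.2)]
      have : ∀ θ, (ball c r).indicator f (circleMap c s θ) = 0 := fun θ =>
        indicator_of_notMem (fun h => hr ((circleMap_mem_ball_iff hs).1 h)) _
      simp [this]
  · rw [indicator_of_notMem (show s ∉ Ioi (0 : ℝ) from hs),
        indicator_of_notMem (show s ∉ Ioo 0 r from fun h => hs h.1)]

theorem lintegral_Ioo_ofReal {r : ℝ} (hr : 0 < r) :
    ∫⁻ s in Ioo 0 r, ENNReal.ofReal s = ENNReal.ofReal (r ^ 2 / 2) := by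
  rw [← ofReal_integral_eq_lintegral_ofReal, ← integral_Ioc_eq_integral_Ioo,
    ← intervalIntegral.integral_of_le hr.le, integral_id]
  · simp
  · exact (continuous_id.integrableOn_Icc).mono_set Ioo_subset_Icc_self
  · exact (ae_restrict_mem measurableSet_Ioo).mono fun s hs => hs.1.le

/-- The mean value inequality over a disc. -/
theorem ofReal_mul_enorm_le_lintegral_ball {f : ℂ → ℂ} {c : ℂ} {r : ℝ} (hr : 0 < r)
    (hf : DifferentiableOn ℂ f (ball c r)) :
    ENNReal.ofReal (Real.pi * r ^ 2) * ‖f c‖ₑ ≤ ∫⁻ z in ball c r, ‖f z‖ₑ := by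
  have hm : Measurable ((ball c r).indicator fun z => ‖f z‖ₑ) := by
    classical
    rw [← piecewise_eq_indicator]
    exact (hf.continuousOn.enorm).measurable_piecewise continuousOn_const measurableSet_ball
  rw [setLIntegral_ball_eq hm]
  have hcirc : ∀ s ∈ Ioo 0 r, ENNReal.ofReal (2 * Real.pi) * ‖f c‖ₑ ≤
      ∫⁻ θ in Ioo (-Real.pi) Real.pi, ‖f (circleMap c s θ)‖ₑ := by
    intro s hs
    have h1 : Real.circleAverage f c s = f c := by
      refine DiffContOnCl.circleAverage ?_
      rw [abs_of_pos hs.1]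
      exact (hf.mono (closedBall_subset_ball hs.2)).diffContOnCl_ball subset_rfl
    -- Polar coordinates use the angles `(-π, π)`, the circle average uses `(0, 2π)`; periodicity
    -- reconciles them.
    have h2 : ∫ θ in (-Real.pi)..Real.pi, f (circleMap c s θ) = (2 * Real.pi : ℝ) • f c := by
      have := ((periodic_circleMap c s).comp f).intervalIntegral_add_eq (-Real.pi) 0
      simp only [Function.comp] at this
      rw [show -Real.pi + 2 * Real.pi = Real.pi by ring, zero_add] at this
      rw [this, ← h1, Real.circleAverage_def, smul_smul, mul_inv_cancel₀ (by positivity), one_smul]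
    have h3 : ENNReal.ofReal (2 * Real.pi) * ‖f c‖ₑ = ‖(2 * Real.pi : ℝ) • f c‖ₑ := by
      rw [enorm_smul, Real.enorm_of_nonneg (by positivity)]
    rw [h3, ← h2, intervalIntegral.integral_of_le (by linarith [Real.pi_pos]),
      restrict_Ioo_eq_restrict_Ioc]
    exact enorm_integral_le_lintegral_enorm _
  calc ENNReal.ofReal (Real.pi * r ^ 2) * ‖f c‖ₑ
      = ∫⁻ s in Ioo 0 r, ENNReal.ofReal s * (ENNReal.ofReal (2 * Real.pi) * ‖f c‖ₑ) := by
        rw [lintegral_mul_const _ ENNReal.measurable_ofReal, lintegral_Ioo_ofReal hr, ← mul_assoc,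
          ← ENNReal.ofReal_mul (by positivity)]
        congr 2
        ring
    _ ≤ _ := setLIntegral_mono' measurableSet_Ioo fun s hs => by gcongr; exact hcirc s hs

/-- The factor `s` of the area element in polar coordinates cancels the pole. Hence a uniform bound
on `(z - c) φ` controls the mass of `φ` near a puncture. -/
theorem lintegral_ball_enorm_inv_lt_top (c : ℂ) (r : ℝ) :
    ∫⁻ z in ball c r, ‖(z - c)⁻¹‖ₑ < ⊤ := by
  have hm : Measurable ((ball c r).indicator fun z => ‖(z - c)⁻¹‖ₑ) :=
    Measurable.indicator (by fun_prop) measurableSet_ball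
  rw [setLIntegral_ball_eq hm]
  have : ∀ s ∈ Ioo 0 r, ENNReal.ofReal s *
      ∫⁻ θ in Ioo (-Real.pi) Real.pi, ‖(circleMap c s θ - c)⁻¹‖ₑ ≤
      ENNReal.ofReal (2 * Real.pi) := by
    intro s hs
    have h : ∀ θ, ‖(circleMap c s θ - c)⁻¹‖ₑ = ENNReal.ofReal s⁻¹ := fun θ => by
      rw [← ofReal_norm]
      simp [circleMap, abs_of_pos hs.1]
    simp only [h, lintegral_const, Measure.restrict_apply_univ, Real.volume_Ioo]
    rw [← mul_assoc, ← ENNReal.ofReal_mul hs.1.le, mul_inv_cancel₀ hs.1.ne']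
    simp [two_mul]
  refine (setLIntegral_mono' measurableSet_Ioo this).trans_lt ?_
  rw [lintegral_const, Measure.restrict_apply_univ, Real.volume_Ioo]
  exact ENNReal.mul_lt_top ENNReal.ofReal_lt_top ENNReal.ofReal_lt_top

/-- A locally bounded sequence of holomorphic functions converges along every ultrafilter. -/
theorem exists_tendstoLocallyUniformlyOn_ultrafilter {ι : Type*} (l : Ultrafilter ι)
    {F : ι → ℂ → ℂ} {U : Set ℂ} (hU : IsOpen U) (hF : ∀ n, DifferentiableOn ℂ (F n) U)
    (hb : ∀ z ∈ U, ∃ r > 0, ∃ M : ℝ, ∀ n, ∀ w ∈ ball z r, w ∈ U → ‖F n w‖ ≤ M) :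
    ∃ G : ℂ → ℂ, TendstoLocallyUniformlyOn F G l U := by
  have hpt : ∀ z, ∃ y, z ∈ U → Tendsto (fun n => F n z) l (𝓝 y) := by
    intro z
    by_cases hz : z ∈ U
    · obtain ⟨r, hr, M, hM⟩ := hb z hz
      -- Along an ultrafilter bounded values converge without passing to a subsequence, so one `l`
      -- serves all points and, later, all charts.
      obtain ⟨y, -, hy⟩ := (isCompact_closedBall (0 : ℂ) M).ultrafilter_le_nhds
        (l.map fun n => F n z) (by
          rw [Ultrafilter.coe_map, le_principal_iff, mem_map]
          exact univ_mem' fun n => by simpa using hM n z (mem_ball_self hr) hz)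
      exact ⟨y, fun _ => hy⟩
    · exact ⟨0, fun h => absurd h hz⟩
  choose G hG using hpt
  refine ⟨G, (tendstoLocallyUniformlyOn_iff_forall_isCompact hU).2 fun K hK hKc => ?_⟩
  have heq : EquicontinuousOn F K := by
    intro z hz
    refine EquicontinuousAt.equicontinuousWithinAt (Metric.equicontinuousAt_iff.2 fun ε hε => ?_) K
    obtain ⟨r, hr, M, hM⟩ := hb z (hK hz)
    obtain ⟨r', hr', hsub⟩ := Metric.isOpen_iff.1 hU z (hK hz)
    set ρ := min r r' with hρ
    have hρ0 : 0 < ρ := lt_min hr hr'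
    have hM0 : 0 ≤ |M| := abs_nonneg M
    -- By the Schwarz lemma each `F n` satisfies `|F n w - F n z| ≤ (2|M|/ρ) |w - z|` on the disc.
    -- The `+ 1` keeps the denominator positive when `M = 0`.
    refine ⟨min ρ (ε * ρ / (2 * |M| + 1)), by positivity, fun w hw n => ?_⟩
    have hsubU : ball z ρ ⊆ U := (ball_subset_ball (min_le_right _ _)).trans hsub
    have hbd : ∀ w ∈ ball z ρ, ‖F n w‖ ≤ |M| := fun w hw =>
      (hM n w (ball_subset_ball (min_le_left _ _) hw) (hsubU hw)).trans (le_abs_self M)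
    have := Complex.dist_le_div_mul_dist_of_mapsTo_ball (R₂ := 2 * |M|) ((hF n).mono hsubU)
      (fun w hw => by
        rw [mem_closedBall, dist_eq_norm]
        refine (norm_sub_le _ _).trans ?_
        linarith [hbd w hw, hbd z (mem_ball_self hρ0)])
      (show w ∈ ball z ρ from hw.trans_le (min_le_left _ _))
    rw [dist_comm]
    refine this.trans_lt ?_
    have h2 : dist w z < ε * ρ / (2 * |M| + 1) := hw.trans_le (min_le_right _ _)
    rw [lt_div_iff₀ (by positivity)] at h2
    rw [div_mul_eq_mul_div, div_lt_iff₀ hρ0]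
    nlinarith [dist_nonneg (x := w) (y := z)]
  -- For an equicontinuous family on a compact set, pointwise convergence is uniform (Ascoli).
  have := (EquicontinuousOn.tendsto_uniformOnFun_iff_pi' (𝔖 := {K}) (by simpa using hKc)
    (by simpa using heq) l G).2 (tendsto_pi_nhds.2 fun z => hG z (hK (by simpa using z.2)))
  exact UniformOnFun.tendsto_iff_tendstoUniformlyOn.1 this K rfl

/-- An integrable holomorphic function on a punctured disc has at most a simple pole. -/
theorem exists_differentiableOn_eq_sub_mul {f : ℂ → ℂ} {c : ℂ} {R : ℝ} (hR : 0 < R)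
    (hf : DifferentiableOn ℂ f (ball c R \ {c}))
    (hint : ∫⁻ z in ball c R \ {c}, ‖f z‖ₑ ≤ 1) :
    ∃ F : ℂ → ℂ, DifferentiableOn ℂ F (ball c R) ∧
      (∀ z ∈ ball c R \ {c}, F z = (z - c) * f z) ∧
      ∀ z ∈ ball c (R / 2), ‖F z‖ ≤ 8 / (Real.pi * R) := by
  have hmean : ∀ z δ, 0 < δ → ball z δ ⊆ ball c R \ {c} →
      ENNReal.ofReal (Real.pi * δ ^ 2 * ‖f z‖) ≤ ∫⁻ w in ball z δ, ‖f w‖ₑ := by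
    intro z δ hδ hsub
    rw [ENNReal.ofReal_mul (by positivity), ofReal_norm]
    exact ofReal_mul_enorm_le_lintegral_ball hδ (hf.mono hsub)
  have hsubc : ∀ z, ∀ δ ≤ dist z c, δ + dist z c ≤ R → ball z δ ⊆ ball c R \ {c} := by
    intro z δ hδ hδR w hw
    rw [mem_ball] at hw
    refine ⟨?_, ?_⟩
    · rw [mem_ball]
      linarith [dist_triangle w z c]
    · rintro rfl
      rw [dist_comm] at hw
      exact absurd hδ (not_le.2 hw)
  set g : ℂ → ℂ := fun z => (z - c) * f z with hg
  have hgd : DifferentiableOn ℂ g (ball c R \ {c}) :=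
    (differentiableOn_id.sub_const c).mul hf
  set F := Function.update g c (limUnder (𝓝[≠] c) g) with hF
  have hFg : ∀ z ∈ ball c R \ {c}, F z = (z - c) * f z := fun z hz =>
    Function.update_of_ne hz.2 _ _
  have hFd : DifferentiableOn ℂ F (ball c R) := by
    -- Removable singularity: it suffices that `|z - c|² |f z| → 0`. Up to a constant the left side
    -- is bounded by the mass of `f` on a shrinking disc about `c`, which tends to zero by absolute
    -- continuity of the integral.
    refine Complex.differentiableOn_update_limUnder_of_isLittleO (ball_mem_nhds c hR) hgd ?_
    set m := volume.restrict (ball c R \ {c}) with hm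
    have hvol : Tendsto (m ∘ fun z => ball c (2 * dist z c)) (𝓝 c) (𝓝 0) := by
      refine tendsto_of_tendsto_of_tendsto_of_le_of_le tendsto_const_nhds ?_ (fun z => zero_le)
        (fun z => Measure.restrict_apply_le _ _)
      have hd : Tendsto (fun z => 2 * dist z c) (𝓝 c) (𝓝 0) := by
        have : Continuous fun z : ℂ => 2 * dist z c := by fun_prop
        simpa using this.tendsto c
      simp only [Complex.volume_ball]
      have h1 := ((ENNReal.continuous_pow 2).tendsto _).comp (ENNReal.tendsto_ofReal hd)
      simpa using ENNReal.Tendsto.mul_const (b := (NNReal.pi : ℝ≥0∞)) h1 (Or.inr (by simp))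
    have hI := tendsto_setLIntegral_zero (ne_top_of_le_ne_top ENNReal.one_ne_top hint) hvol
    refine Asymptotics.isLittleO_iff.2 fun ε hε => ?_
    have hε' : (0 : ℝ≥0∞) < ENNReal.ofReal (Real.pi * ε / 4) :=
      ENNReal.ofReal_pos.2 (by positivity)
    filter_upwards [(hI.mono_left nhdsWithin_le_nhds).eventually (gt_mem_nhds hε'),
      self_mem_nhdsWithin, nhdsWithin_le_nhds (ball_mem_nhds c (half_pos hR))] with z hz hzc hzR
    have hzc' : 0 < dist z c := dist_pos.2 hzc
    rw [mem_ball] at hzR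
    -- The disc of radius `|z - c|/2` about `z` misses `c`, so the mean value inequality applies on
    -- it.
    have hsub : ball z (dist z c / 2) ⊆ ball c R \ {c} := hsubc _ _ (by linarith) (by linarith)
    have h1 := hmean z (dist z c / 2) (half_pos hzc') hsub
    have h2 : ∫⁻ w in ball z (dist z c / 2), ‖f w‖ₑ ≤
        ∫⁻ w in ball c (2 * dist z c), ‖f w‖ₑ ∂m := by
      rw [hm, Measure.restrict_restrict measurableSet_ball]
      refine lintegral_mono_set (subset_inter (ball_subset_ball' (by linarith)) hsub)
    have h3 := (ENNReal.ofReal_le_ofReal_iff (by positivity)).1 ((h1.trans h2).trans hz.le)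
    have h4 : dist z c ^ 2 * ‖f z‖ ≤ ε := by
      have : Real.pi * (dist z c ^ 2 * ‖f z‖) ≤ Real.pi * ε := by nlinarith
      exact le_of_mul_le_mul_left this Real.pi_pos
    simp only [hg, sub_self, zero_mul, sub_zero, norm_mul, norm_inv]
    rw [← dist_eq_norm, ← div_eq_mul_inv, le_div_iff₀ hzc']
    linarith
  refine ⟨F, hFd, hFg, fun z hz => ?_⟩
  -- By the maximum principle it suffices to bound `F` on `|w - c| = R/2`. There the mean value
  -- inequality on a disc of radius `R/4` gives `|f w| ≤ 16/(π R²)`, and the factor `R/2` turns this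
  -- into `8/(π R)`.
  refine Complex.norm_le_of_forall_mem_frontier_norm_le (isBounded_ball (x := c) (r := R / 2))
    ((hFd.mono (closedBall_subset_ball (half_lt_self hR))).diffContOnCl_ball subset_rfl)
    (fun w hw => ?_) (subset_closure hz)
  rw [frontier_ball c (half_pos hR).ne', mem_sphere] at hw
  have h1 := (hmean w (R / 4) (by positivity) (hsubc _ _ (by linarith) (by linarith))).trans
    ((lintegral_mono_set (hsubc _ _ (by linarith) (by linarith))).trans hint)
  rw [ENNReal.ofReal_le_one] at h1
  rw [hFg w (hsubc w (R / 4) (by linarith) (by linarith) (mem_ball_self (by positivity))),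
    norm_mul, ← dist_eq_norm, hw, le_div_iff₀ (by positivity)]
  nlinarith

/-- The inverse of an injective holomorphic function is holomorphic. -/
theorem differentiableOn_symm_of_differentiableOn (h : OpenPartialHomeomorph ℂ ℂ)
    (hd : DifferentiableOn ℂ h h.source) : DifferentiableOn ℂ h.symm h.target := by
  intro a ha
  have hz := h.map_target ha
  have han : AnalyticAt ℂ h (h.symm a) := hd.analyticAt (h.open_source.mem_nhds hz)
  refine (Complex.analyticAt_of_differentiable_on_punctured_nhds_of_continuousAt ?_
    (h.continuousAt_symm ha)).differentiableAt.differentiableWithinAt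
  -- If the derivative vanishes identically near the point, `h` is locally constant, against
  -- injectivity. Otherwise critical points are isolated: the inverse is holomorphic near `a` except
  -- perhaps at `a`, and continuous there, so the singularity is removable.
  rcases han.deriv.eventually_eq_zero_or_eventually_ne_zero with h0 | h0
  · exfalso
    obtain ⟨r, hr, hsub⟩ := Metric.mem_nhds_iff.1
      (h0.and (h.open_source.mem_nhds hz))
    obtain ⟨w, hw, hne⟩ : ∃ w ∈ ball (h.symm a) r, w ≠ h.symm a := by
      refine ⟨h.symm a + (r / 2 : ℝ), ?_, ?_⟩
      · simp [abs_of_pos hr, hr]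
      · simp [hr.ne']
    refine hne (h.injOn (hsub hw).2 hz ?_)
    exact isOpen_ball.is_const_of_deriv_eq_zero (convex_ball _ _).isPreconnected
      (hd.mono fun w hw => (hsub hw).2) (fun w hw => (hsub hw).1) hw (mem_ball_self hr)
  · have ht : Tendsto h.symm (𝓝[≠] a) (𝓝[≠] (h.symm a)) := by
      refine tendsto_nhdsWithin_iff.2
        ⟨(h.continuousAt_symm ha).mono_left nhdsWithin_le_nhds, ?_⟩
      filter_upwards [self_mem_nhdsWithin, nhdsWithin_le_nhds (h.open_target.mem_nhds ha)]
        with b hb hbt hba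
      exact hb (h.symm.injOn hbt ha hba)
    filter_upwards [ht.eventually h0, nhdsWithin_le_nhds (h.open_target.mem_nhds ha)] with b hb hbt
    exact (h.hasDerivAt_symm hbt hb ((hd.differentiableAt
      (h.open_source.mem_nhds (h.map_target hbt))).hasDerivAt)).differentiableAt

end ComplexAnalysis

/-! ### Coordinate changes: cocycle identity and chain rule -/

section Transition

variable {X : Type u} [TopologicalSpace X] [ChartedSpace ℂ X]

theorem isOpen_overlap (e e' : Chart X) : IsOpen (overlap e e') :=
  e.1.isOpen_inter_preimage_symm e'.1.open_source

theorem trans_mem_overlap {e e' e'' : Chart X} {z : ℂ} (h : z ∈ overlap e e')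
    (h' : z ∈ overlap e e'') : trans e e' z ∈ overlap e' e'' := by
  refine ⟨e'.1.map_source h.2, ?_⟩
  rw [trans, e'.1.left_inv h.2]
  exact h'.2

theorem trans_trans {e e' : Chart X} (e'' : Chart X) {z : ℂ} (h : z ∈ overlap e e') :
    trans e' e'' (trans e e' z) = trans e e'' z := by
  simp only [trans]
  rw [e'.1.left_inv h.2]

theorem trans_self {e : Chart X} {z : ℂ} (h : z ∈ e.1.target) : trans e e z = z :=
  e.1.right_inv h

theorem mem_overlap_self {e : Chart X} {z : ℂ} (h : z ∈ e.1.target) : z ∈ overlap e e :=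
  ⟨h, e.1.map_target h⟩

theorem deriv_trans_self {e : Chart X} {z : ℂ} (h : z ∈ e.1.target) :
    deriv (trans e e) z = 1 := by
  have : trans e e =ᶠ[𝓝 z] id := by
    filter_upwards [e.1.open_target.mem_nhds h] with w hw using trans_self hw
  rw [this.deriv_eq, deriv_id]

theorem deriv_trans_trans [IsManifold 𝓘(ℂ) ω X] {e e' e'' : Chart X} {z : ℂ}
    (h : z ∈ overlap e e') (h' : z ∈ overlap e e'') :
    deriv (trans e' e'') (trans e e' z) * deriv (trans e e') z = deriv (trans e e'') z := by
  have heq : trans e e'' =ᶠ[𝓝 z] trans e' e'' ∘ trans e e' := by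
    filter_upwards [(isOpen_overlap e e').mem_nhds h] with w hw using (trans_trans e'' hw).symm
  rw [heq.deriv_eq, deriv_comp _ (differentiableAt_trans (trans_mem_overlap h h'))
    (differentiableAt_trans h)]

theorem ChartCover.measurableSet_image_piece (C : ChartCover X) (n : ℕ) :
    MeasurableSet ((C.chart n).1 '' C.piece n) := by
  simpa using C.measurableSet_image C (C.chart n) n n fun x hx => hx.1.1

theorem ChartCover.image_piece_subset (C : ChartCover X) (n : ℕ) :
    (C.chart n).1 '' C.piece n ⊆ (C.chart n).1.target := by
  rintro _ ⟨x, hx, rfl⟩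
  exact (C.chart n).1.map_source hx.1

end Transition

/-! ### Passage to the maximal atlas -/

section FullAtlas

/-- The surface `X` with its maximal holomorphic atlas. -/
def FullAtlas (X : Type u) : Type u := X

variable {X : Type u} [TopologicalSpace X] [ChartedSpace ℂ X] [IsManifold 𝓘(ℂ) ω X]

instance : TopologicalSpace (FullAtlas X) := inferInstanceAs (TopologicalSpace X)

instance [h : SecondCountableTopology X] : SecondCountableTopology (FullAtlas X) := h

instance [h : Nonempty X] : Nonempty (FullAtlas X) := h

instance : ChartedSpace ℂ (FullAtlas X) where
  atlas := IsManifold.maximalAtlas 𝓘(ℂ) ω X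
  chartAt x := chartAt (M := X) ℂ x
  mem_chart_source x := mem_chart_source (M := X) ℂ x
  chart_mem_atlas x := IsManifold.chart_mem_maximalAtlas (M := X) x

instance : HasGroupoid (FullAtlas X) (contDiffGroupoid ω 𝓘(ℂ)) where
  compatible he he' := IsManifold.compatible_of_mem_maximalAtlas (M := X) he he'

instance : IsManifold 𝓘(ℂ) ω (FullAtlas X) := IsManifold.mk' _ _ _

/-- A chart of the given atlas as a chart of the maximal atlas. -/
def Chart.full (e : Chart X) : Chart (FullAtlas X) :=
  ⟨e.1, IsManifold.subset_maximalAtlas (I := 𝓘(ℂ)) (n := ω) e.2⟩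

/-- A chart cover of the given atlas as a chart cover of the maximal atlas. -/
def ChartCover.full (C : ChartCover X) : ChartCover (FullAtlas X) where
  chart n := (C.chart n).full
  cover := C.cover

variable (X) in
/-- The preferred chart at a point of the maximal atlas, taken from the given atlas. -/
def preferredChart (x : FullAtlas X) : Chart X :=
  ⟨chartAt (M := X) ℂ x, chart_mem_atlas (M := X) ℂ x⟩

namespace HolomorphicQuadraticDifferential

/-- The local expression of a quadratic differential in a chart of the maximal atlas. -/
def fullCoeff (φ : HolomorphicQuadraticDifferential X) (f : Chart (FullAtlas X)) (z : ℂ) : ℂ :=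
  φ.coeff (preferredChart X (f.1.symm z)) (trans f (preferredChart X (f.1.symm z)).full z) *
    deriv (trans f (preferredChart X (f.1.symm z)).full) z ^ 2

/-- The preferred chart in the definition varies with `z`. By the chain rule and the transformation
law of `φ`, any one chart of the given atlas may replace it, so holomorphy and the transformation
law can be checked with a chart held fixed near `z`. -/
theorem fullCoeff_eq (φ : HolomorphicQuadraticDifferential X) {f : Chart (FullAtlas X)}
    {e : Chart X} {z : ℂ} (hz : z ∈ overlap f e.full) :
    φ.fullCoeff f z = φ.coeff e (trans f e.full z) * deriv (trans f e.full) z ^ 2 := by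
  have h0 : z ∈ overlap f (preferredChart X (f.1.symm z)).full :=
    ⟨hz.1, mem_chart_source (M := X) ℂ _⟩
  have h1 := φ.transform (preferredChart X (f.1.symm z)) e _
    (trans_mem_overlap (e' := (preferredChart X (f.1.symm z)).full) (e'' := e.full) h0 hz)
  rw [fullCoeff, h1, ← deriv_trans_trans h0 hz, ← trans_trans e.full h0, mul_pow, mul_assoc]
  rfl

theorem fullCoeff_full (φ : HolomorphicQuadraticDifferential X) {e : Chart X} {z : ℂ}
    (hz : z ∈ e.1.target) : φ.fullCoeff e.full z = φ.coeff e z := by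
  rw [φ.fullCoeff_eq (mem_overlap_self (e := e.full) hz), trans_self (e := e.full) hz,
    deriv_trans_self (e := e.full) hz, one_pow, mul_one]

/-- A quadratic differential extends to the maximal atlas. -/
def full (φ : HolomorphicQuadraticDifferential X) :
    HolomorphicQuadraticDifferential (FullAtlas X) where
  coeff := φ.fullCoeff
  holomorphic f z hz := by
    set e := preferredChart X (f.1.symm z)
    have hzo : z ∈ overlap f e.full := ⟨hz, mem_chart_source (M := X) ℂ _⟩
    have hO := (isOpen_overlap f e.full).mem_nhds hzo
    have hd : DifferentiableOn ℂ (trans f e.full) (overlap f e.full) := fun w hw =>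
      (differentiableAt_trans hw).differentiableWithinAt
    have heq : φ.fullCoeff f =ᶠ[𝓝 z] fun w =>
        φ.coeff e (trans f e.full w) * deriv (trans f e.full) w ^ 2 := by
      filter_upwards [hO] with w hw using φ.fullCoeff_eq hw
    refine (DifferentiableAt.congr_of_eventuallyEq ?_ heq).differentiableWithinAt
    refine DifferentiableAt.mul ?_
      (((hd.deriv (isOpen_overlap _ _)).differentiableAt hO).pow 2)
    exact DifferentiableAt.comp z ((φ.holomorphic e).differentiableAt
      (e.1.open_target.mem_nhds (e.1.map_source hzo.2))) (hd.differentiableAt hO)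
  transform f f' z hz := by
    set e := preferredChart X (f.1.symm z)
    have hzo : z ∈ overlap f e.full := ⟨hz.1, mem_chart_source (M := X) ℂ _⟩
    rw [φ.fullCoeff_eq hzo, φ.fullCoeff_eq (trans_mem_overlap hz hzo), trans_trans _ hz,
      ← deriv_trans_trans hz hzo, mul_pow, mul_assoc]

/-- The restriction of a quadratic differential on the maximal atlas to the given atlas. -/
def ofFull (φ : HolomorphicQuadraticDifferential (FullAtlas X)) :
    HolomorphicQuadraticDifferential X where
  coeff e := φ.coeff e.full
  holomorphic e := φ.holomorphic e.full
  transform e e' := φ.transform e.full e'.full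

end HolomorphicQuadraticDifferential

namespace HolomorphicQuadraticDifferential

variable [SecondCountableTopology X] [Nonempty X]

theorem l1Norm_congr {φ ψ : HolomorphicQuadraticDifferential X}
    (h : ∀ e : Chart X, EqOn (φ.coeff e) (ψ.coeff e) e.1.target) : φ.l1Norm = ψ.l1Norm := by
  obtain ⟨C⟩ := ChartCover.nonempty (X := X)
  rw [l1Norm_eq _ C, l1Norm_eq _ C]
  exact tsum_congr fun n => setLIntegral_congr_fun (C.measurableSet_image_piece n) fun z hz =>
    congrArg enorm (h _ (C.image_piece_subset n hz))

theorem l1Norm_ofFull (φ : HolomorphicQuadraticDifferential (FullAtlas X)) :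
    φ.ofFull.l1Norm = φ.l1Norm := by
  obtain ⟨C⟩ := ChartCover.nonempty (X := X)
  rw [l1Norm_eq _ C, l1Norm_eq _ C.full]
  rfl

theorem l1Norm_full (φ : HolomorphicQuadraticDifferential X) : φ.full.l1Norm = φ.l1Norm := by
  rw [← l1Norm_ofFull]
  exact l1Norm_congr fun e z hz => φ.fullCoeff_full hz

end HolomorphicQuadraticDifferential

end FullAtlas

/-! ### Punctured coordinate discs on an analytically finite surface -/

section AnalyticallyFinite

/-- Holomorphic functions are analytic, and the inverse is holomorphic by
`differentiableOn_symm_of_differentiableOn`. -/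
theorem mem_contDiffGroupoid_of_differentiableOn (h : OpenPartialHomeomorph ℂ ℂ)
    (hd : DifferentiableOn ℂ h h.source) : h ∈ contDiffGroupoid ω 𝓘(ℂ) := by
  refine mem_groupoid_of_pregroupoid.2 ⟨?_, ?_⟩
  · simpa [contDiffPregroupoid] using hd.contDiffOn h.open_source
  · simpa [contDiffPregroupoid] using
      (differentiableOn_symm_of_differentiableOn h hd).contDiffOn h.open_target

variable {X : Type u} [TopologicalSpace X] [ChartedSpace ℂ X] [IsManifold 𝓘(ℂ) ω X]

/-- The pullback of a chart under a holomorphic open embedding is a holomorphic chart. -/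
theorem isOpenEmbedding_trans_mem_maximalAtlas [Nonempty X] {S : Type u} [TopologicalSpace S]
    [ChartedSpace ℂ S] [IsManifold 𝓘(ℂ) ω S] {ι : X → S} (hd : MDifferentiable 𝓘(ℂ) 𝓘(ℂ) ι)
    (hι : Topology.IsOpenEmbedding ι) {f : OpenPartialHomeomorph S ℂ} (hf : f ∈ atlas ℂ S) :
    hι.toOpenPartialHomeomorph ι ≫ₕ f ∈ IsManifold.maximalAtlas 𝓘(ℂ) ω X := by
  rw [IsManifold.maximalAtlas, mem_maximalAtlas_iff]
  intro e he
  set g := hι.toOpenPartialHomeomorph ι ≫ₕ f with hg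
  -- This is the coordinate expression of `ι`, hence holomorphic; the other coordinate change is its
  -- inverse.
  have key : e.symm ≫ₕ g ∈ contDiffGroupoid ω 𝓘(ℂ) := by
    refine mem_contDiffGroupoid_of_differentiableOn _ fun z hz => ?_
    have hz1 : z ∈ e.target := hz.1
    have hz2 : ι (e.symm z) ∈ f.source := by simpa [hg] using hz.2
    have := MDifferentiableAt.comp (I := 𝓘(ℂ)) (I' := 𝓘(ℂ)) (I'' := 𝓘(ℂ)) z
      (mdifferentiableAt_atlas hf hz2)
      (MDifferentiableAt.comp z (hd (e.symm z)) (mdifferentiableAt_atlas_symm he hz1))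
    exact (mdifferentiableAt_iff_differentiableAt.1 this).differentiableWithinAt
  refine ⟨?_, key⟩
  have := (contDiffGroupoid ω 𝓘(ℂ)).symm key
  rwa [OpenPartialHomeomorph.trans_symm_eq_symm_trans_symm,
    OpenPartialHomeomorph.symm_symm] at this

/-- An analytically finite surface is covered by finitely many coordinate discs, each contained in
a larger disc whose center may be a puncture. -/
theorem AnalyticallyFinite.exists_punctured_discs [Nonempty X] (hX : AnalyticallyFinite X) :
    ∃ (N : ℕ) (g : Fin N → Chart (FullAtlas X)) (c : Fin N → ℂ) (R : Fin N → ℝ),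
      (∀ i, 0 < R i) ∧ (∀ i, ball (c i) (R i) \ {c i} ⊆ (g i).1.target) ∧
      ∀ x : FullAtlas X, ∃ i, x ∈ (g i).1.source ∧ (g i).1 x ∈ ball (c i) (R i / 4) := by
  obtain ⟨S, _, _, _, _, _, _, ι, hd, hι, hfin⟩ := hX
  have hR : ∀ p : S, ∃ R > 0, ball (chartAt ℂ p p) R \ {chartAt ℂ p p} ⊆
      (hι.toOpenPartialHomeomorph ι ≫ₕ chartAt ℂ p).target := by
    intro p
    -- The complement is finite, hence closed: around `p` there is a disc with no puncture except
    -- perhaps `p` itself.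
    have ho : IsOpen (range ι ∪ {p}) := by
      rw [← isClosed_compl_iff]
      exact (hfin.subset (compl_subset_compl.2 subset_union_left)).isClosed
    obtain ⟨R, hR, hsub⟩ := Metric.isOpen_iff.1
      ((chartAt ℂ p).isOpen_inter_preimage_symm ho) (chartAt ℂ p p)
      ⟨mem_chart_target ℂ p, by simp⟩
    refine ⟨R, hR, fun z hz => ?_⟩
    obtain ⟨h1, h2⟩ := hsub hz.1
    refine ⟨h1, ?_⟩
    rcases h2 with h2 | h2
    · simpa using h2
    · refine absurd ?_ hz.2
      rw [mem_singleton_iff, ← (chartAt ℂ p).right_inv h1, mem_singleton_iff.1 h2]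
  choose R hR0 hR using hR
  -- The discs of quarter radius already cover. This leaves room for a bound on the half disc and
  -- uniform convergence on the closed quarter disc inside it.
  obtain ⟨t, ht⟩ := CompactSpace.elim_nhds_subcover
    (fun p : S => (chartAt ℂ p).source ∩ chartAt ℂ p ⁻¹' ball (chartAt ℂ p p) (R p / 4))
    fun p => ((chartAt ℂ p).isOpen_inter_preimage isOpen_ball).mem_nhds
      ⟨mem_chart_source ℂ p, mem_ball_self (by linarith [hR0 p])⟩
  refine ⟨t.card, fun i => ⟨hι.toOpenPartialHomeomorph ι ≫ₕ chartAt ℂ (t.equivFin.symm i : S),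
    isOpenEmbedding_trans_mem_maximalAtlas hd hι (chart_mem_atlas ℂ _)⟩,
    fun i => chartAt ℂ (t.equivFin.symm i : S) (t.equivFin.symm i : S),
    fun i => R (t.equivFin.symm i), fun i => hR0 _, fun i => hR _, fun x => ?_⟩
  have hx : ι x ∈ ⋃ p ∈ t, (chartAt ℂ p).source ∩
      chartAt ℂ p ⁻¹' ball (chartAt ℂ p p) (R p / 4) := by rw [ht]; trivial
  simp only [mem_iUnion] at hx
  obtain ⟨p, hp, hx1, hx2⟩ := hx
  refine ⟨t.equivFin ⟨p, hp⟩, ?_, ?_⟩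
  · refine ⟨trivial, ?_⟩
    simp only [Equiv.symm_apply_apply]
    exact hx1
  · simp only [Equiv.symm_apply_apply]
    exact hx2

end AnalyticallyFinite

/-! ### Differences and scalar multiples of quadratic differentials -/

namespace HolomorphicQuadraticDifferential

variable {X : Type u} [TopologicalSpace X] [ChartedSpace ℂ X]

instance : Sub (HolomorphicQuadraticDifferential X) where
  sub φ ψ :=
    { coeff := fun e z => φ.coeff e z - ψ.coeff e z
      holomorphic := fun e => (φ.holomorphic e).sub (ψ.holomorphic e)
      transform := fun e e' z hz => by
        rw [φ.transform e e' z hz, ψ.transform e e' z hz, sub_mul] }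

instance : SMul ℂ (HolomorphicQuadraticDifferential X) where
  smul a φ :=
    { coeff := fun e z => a * φ.coeff e z
      holomorphic := fun e => (φ.holomorphic e).const_mul a
      transform := fun e e' z hz => by
        rw [φ.transform e e' z hz, mul_assoc] }

theorem sub_coeff (φ ψ : HolomorphicQuadraticDifferential X) (e : Chart X) (z : ℂ) :
    (φ - ψ).coeff e z = φ.coeff e z - ψ.coeff e z := rfl

theorem smul_coeff (a : ℂ) (φ : HolomorphicQuadraticDifferential X) (e : Chart X) (z : ℂ) :
    (a • φ).coeff e z = a * φ.coeff e z := rfl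

end HolomorphicQuadraticDifferential

/-! ### Local bounds, normal families and behavior at punctures -/

section LocalBounds

variable {X : Type u} [TopologicalSpace X] [ChartedSpace ℂ X]

/-- The chart cover whose first chart is `e`. -/
def ChartCover.cons (e : Chart X) (C : ChartCover X) : ChartCover X where
  chart n := Nat.casesOn n e C.chart
  cover x := (C.cover x).imp' (· + 1) fun _ h => h

theorem ChartCover.image_piece_cons_zero (e : Chart X) (C : ChartCover X) :
    ((C.cons e).chart 0).1 '' (C.cons e).piece 0 = e.1.target := by
  have : (C.cons e).piece 0 = e.1.source := by simp [ChartCover.piece, ChartCover.cons]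
  rw [this]
  exact e.1.image_source_eq_target

variable [IsManifold 𝓘(ℂ) ω X] [SecondCountableTopology X] [Nonempty X]

/-- In a cover that begins with `e`, the first piece is the whole domain of `e`, so the integral
over it is one term of the series for the norm. -/
theorem HolomorphicQuadraticDifferential.lintegral_target_le
    (φ : HolomorphicQuadraticDifferential X) (e : Chart X) :
    ∫⁻ z in e.1.target, ‖φ.coeff e z‖ₑ ≤ φ.l1Norm := by
  obtain ⟨C⟩ := ChartCover.nonempty (X := X)
  rw [l1Norm_eq φ (C.cons e), ← C.image_piece_cons_zero e]
  exact ENNReal.le_tsum (f := fun n => ∫⁻ z in ((C.cons e).chart n).1 '' (C.cons e).piece n,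
    ‖φ.coeff ((C.cons e).chart n) z‖ₑ) 0

/-- The mean value inequality on discs of a fixed radius bounds the values by the norm. The bound
does not depend on `φ`, which is what a normal family needs. -/
theorem HolomorphicQuadraticDifferential.exists_bound {e : Chart X} {z : ℂ}
    (hz : z ∈ e.1.target) : ∃ r > 0, ∃ M : ℝ, ∀ φ : HolomorphicQuadraticDifferential X,
      φ.l1Norm ≤ 1 → ∀ w ∈ ball z r, ‖φ.coeff e w‖ ≤ M := by
  obtain ⟨R, hR, hsub⟩ := Metric.isOpen_iff.1 e.1.open_target z hz
  refine ⟨R / 2, half_pos hR, (Real.pi * (R / 2) ^ 2)⁻¹, fun φ hφ w hw => ?_⟩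
  rw [mem_ball] at hw
  have hsub' : ball w (R / 2) ⊆ e.1.target := (ball_subset_ball' (by linarith)).trans hsub
  have h := ((ofReal_mul_enorm_le_lintegral_ball (half_pos hR)
    ((φ.holomorphic e).mono hsub')).trans (lintegral_mono_set hsub')).trans
    ((φ.lintegral_target_le e).trans hφ)
  rw [← ofReal_norm, ← ENNReal.ofReal_mul (by positivity), ENNReal.ofReal_le_one] at h
  rwa [← one_div, le_div_iff₀' (by positivity)]

/-- Normal families: bounded sequences in `A²` converge locally uniformly along ultrafilters. -/
theorem HolomorphicQuadraticDifferential.exists_tendstoLocallyUniformlyOn {ι : Type*}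
    (l : Ultrafilter ι) (φ : ι → HolomorphicQuadraticDifferential X)
    (hφ : ∀ n, (φ n).l1Norm ≤ 1) : ∃ ψ : HolomorphicQuadraticDifferential X, ∀ e : Chart X,
      TendstoLocallyUniformlyOn (fun n => (φ n).coeff e) (ψ.coeff e) l e.1.target := by
  have h : ∀ e : Chart X, ∃ G, TendstoLocallyUniformlyOn (fun n => (φ n).coeff e) G l
      e.1.target := fun e =>
    exists_tendstoLocallyUniformlyOn_ultrafilter l e.1.open_target
      (fun n => (φ n).holomorphic e) fun z hz => by
        obtain ⟨r, hr, M, hM⟩ := exists_bound hz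
        exact ⟨r, hr, M, fun n w hw _ => hM _ (hφ n) w hw⟩
  choose G hG using h
  refine ⟨⟨G, fun e => (hG e).differentiableOn
    (Eventually.of_forall fun n => (φ n).holomorphic e) e.1.open_target, fun e e' z hz => ?_⟩, hG⟩
  refine tendsto_nhds_unique ((hG e).tendsto_at hz.1) ?_
  simp only [(φ _).transform e e' z hz]
  exact ((hG e').tendsto_at (e'.1.map_source hz.2)).mul_const _

/-- No mass escapes into a puncture. -/
theorem HolomorphicQuadraticDifferential.tendsto_lintegral_ball {ι : Type*}
    (l : Ultrafilter ι) {φ : ι → HolomorphicQuadraticDifferential X}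
    (hφ : ∀ n, (φ n).l1Norm ≤ 1) {ψ : HolomorphicQuadraticDifferential X} {g : Chart X}
    (hψ : TendstoLocallyUniformlyOn (fun n => (φ n).coeff g) (ψ.coeff g) l g.1.target)
    {c : ℂ} {R : ℝ} (hR : 0 < R) (hg : ball c R \ {c} ⊆ g.1.target) :
    Tendsto (fun n => ∫⁻ z in ball c (R / 4), ‖(φ n - ψ).coeff g z‖ₑ) l (𝓝 0) := by
  -- The functions `F n = (z - c) φ n` extend over the puncture with a bound independent of `n`. So
  -- they converge uniformly near `c` as well, where the convergence of `φ n` itself says nothing.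
  have hF := fun n => exists_differentiableOn_eq_sub_mul hR (((φ n).holomorphic g).mono hg)
    ((lintegral_mono_set hg).trans (((φ n).lintegral_target_le g).trans (hφ n)))
  choose F hFd hFe hFb using hF
  have hsub : ball c (R / 2) ⊆ ball c R := ball_subset_ball (by linarith)
  obtain ⟨G, hG⟩ := exists_tendstoLocallyUniformlyOn_ultrafilter l (isOpen_ball (x := c))
    (fun n => (hFd n).mono hsub) fun z hz => ⟨R, hR, _, fun n w _ hw => hFb n w hw⟩
  have hGe : ∀ z ∈ ball c (R / 2) \ {c}, G z = (z - c) * ψ.coeff g z := fun z hz => by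
    refine tendsto_nhds_unique (hG.tendsto_at hz.1) ?_
    simp only [hFe _ z ⟨hsub hz.1, hz.2⟩]
    exact (hψ.tendsto_at (hg ⟨hsub hz.1, hz.2⟩)).const_mul _
  have hu := (tendstoLocallyUniformlyOn_iff_forall_isCompact isOpen_ball).1 hG
    (closedBall c (R / 4)) (closedBall_subset_ball (by linarith)) (isCompact_closedBall c _)
  refine ENNReal.tendsto_nhds_zero.2 fun ε hε => ?_
  -- If `|F n - G| < δ`, then `|φ n - ψ| ≤ δ/|z - c|`, whose integral over the disc is less than
  -- `ε`.
  obtain ⟨δ, hδ, hδε⟩ := ENNReal.exists_nnreal_pos_mul_lt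
    (lintegral_ball_enorm_inv_lt_top c (R / 4)).ne hε.ne'
  filter_upwards [Metric.tendstoUniformlyOn_iff.1 hu δ (NNReal.coe_pos.2 hδ)] with n hn
  refine le_trans ?_ hδε.le
  rw [← lintegral_const_mul' _ _ ENNReal.coe_ne_top]
  have hne : ∀ᵐ z : ℂ, z ≠ c := compl_mem_ae_iff.2 (measure_singleton c)
  refine setLIntegral_mono_ae' measurableSet_ball (hne.mono fun z hzc hz => ?_)
  have hz2 : z ∈ ball c (R / 2) := ball_subset_ball (by linarith) hz
  have h1 := hn z (ball_subset_closedBall hz)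
  have hzc' : z - c ≠ 0 := sub_ne_zero.2 hzc
  rw [dist_comm, dist_eq_norm, hGe z ⟨hz2, hzc⟩, hFe n z ⟨hsub hz2, hzc⟩, ← mul_sub] at h1
  rw [sub_coeff, show (φ n).coeff g z - ψ.coeff g z =
    ((z - c) * ((φ n).coeff g z - ψ.coeff g z)) * (z - c)⁻¹ by field_simp, enorm_mul]
  gcongr
  exact_mod_cast h1.le

end LocalBounds

/-! ### Norm compactness of bounded sets in `A²` -/

section Compactness

variable {X : Type u} [TopologicalSpace X] [ChartedSpace ℂ X]

theorem restr_mem_isManifold_maximalAtlas {e : OpenPartialHomeomorph X ℂ}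
    (he : e ∈ IsManifold.maximalAtlas 𝓘(ℂ) ω X) {s : Set X} (hs : IsOpen s) :
    e.restr s ∈ IsManifold.maximalAtlas 𝓘(ℂ) ω X :=
  restr_mem_maximalAtlas (contDiffGroupoid ω 𝓘(ℂ)) he hs

/-- Meant for a chart and its restriction to a smaller domain: the coordinate is the same, so the
derivative in the transformation law is `1`. -/
theorem HolomorphicQuadraticDifferential.coeff_eq_of_trans_eq
    (φ : HolomorphicQuadraticDifferential X) {e e' : Chart X} {z : ℂ} (hz : z ∈ overlap e e')
    (h : EqOn (trans e e') id (overlap e e')) : φ.coeff e z = φ.coeff e' z := by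
  have heq : trans e e' =ᶠ[𝓝 z] id := by
    filter_upwards [(isOpen_overlap e e').mem_nhds hz] with w hw using h hw
  rw [φ.transform e e' z hz, heq.deriv_eq, deriv_id, h hz]
  simp

variable [IsManifold 𝓘(ℂ) ω X] [SecondCountableTopology X] [Nonempty X]

/-- `‖φ‖₁` is at most the sum of the masses of `φ` on finitely many coordinate discs which cover
the surface. -/
theorem HolomorphicQuadraticDifferential.l1Norm_le_sum {N : ℕ} (g : Fin N → Chart (FullAtlas X))
    (U : Fin N → Set ℂ) (hU : ∀ i, IsOpen (U i))
    (hcov : ∀ x : FullAtlas X, ∃ i, x ∈ (g i).1.source ∧ (g i).1 x ∈ U i)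
    (φ : HolomorphicQuadraticDifferential (FullAtlas X)) :
    φ.l1Norm ≤ ∑ i, ∫⁻ z in U i, ‖φ.coeff (g i) z‖ₑ := by
  have hopen : ∀ i, IsOpen ((g i).1.source ∩ (g i).1 ⁻¹' U i) := fun i =>
    (g i).1.isOpen_inter_preimage (hU i)
  -- Each chart is cut down to its disc, so that the pieces of the resulting cover lie in the discs.
  -- The restrictions are charts because the atlas is maximal.
  let h : Fin N → Chart (FullAtlas X) := fun i =>
    ⟨(g i).1.restr ((g i).1.source ∩ (g i).1 ⁻¹' U i),
      restr_mem_isManifold_maximalAtlas (X := X) (g i).2 (hopen i)⟩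
  have hsrc : ∀ i, (h i).1.source = (g i).1.source ∩ (g i).1 ⁻¹' U i := fun i => by
    simp only [h, OpenPartialHomeomorph.restr_source, (hopen i).interior_eq, ← inter_assoc,
      inter_self]
  have hN : 0 < N := by
    obtain ⟨i, -⟩ := hcov (Classical.arbitrary _)
    exact i.pos
  let C : ChartCover (FullAtlas X) :=
    -- A cover is an infinite sequence; the filler charts from index `N` on contribute empty pieces.
    { chart := fun n => if hn : n < N then h ⟨n, hn⟩ else h ⟨0, hN⟩
      cover := fun x => by
        obtain ⟨i, hi⟩ := hcov x
        refine ⟨i, ?_⟩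
        rw [dif_pos i.2, hsrc]
        exact hi }
  have hCi : ∀ i : Fin N, C.chart i = h i := fun i => dif_pos i.2
  have hempty : ∀ n, N ≤ n → C.piece n = ∅ := by
    intro n hn
    refine eq_empty_of_forall_notMem fun x hx => hx.2 ?_
    obtain ⟨i, hi⟩ := hcov x
    refine mem_biUnion (show (i : ℕ) < n from i.2.trans_le hn) ?_
    rw [hCi, hsrc]
    exact hi
  rw [l1Norm_eq φ C, ChartCover.lintegral, tsum_eq_sum (s := Finset.range N), Finset.sum_range]
  · refine Finset.sum_le_sum fun i _ => ?_
    have himg : (C.chart i).1 '' C.piece i ⊆ U i := by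
      rintro _ ⟨x, hx, rfl⟩
      have := C.piece_subset i hx
      rw [hCi, hsrc] at this
      rw [hCi]
      exact this.2
    refine le_trans (setLIntegral_mono' (C.measurableSet_image_piece i) fun z hz => ?_)
      (lintegral_mono_set himg)
    have hzt := C.image_piece_subset i hz
    rw [hCi] at hzt ⊢
    have hgt : ∀ w ∈ (h i).1.target, w ∈ (g i).1.target := fun w hw => hw.1
    rw [φ.coeff_eq_of_trans_eq (e := h i) (e' := g i) ⟨hzt, (g i).1.map_target (hgt z hzt)⟩
      fun w hw => (g i).1.right_inv (hgt w hw.1)]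
  · intro n hn
    rw [hempty n (by simpa using hn), image_empty, Measure.restrict_empty, lintegral_zero_measure]

/-- On an analytically finite surface bounded sets of `A²` are relatively compact. -/
theorem AnalyticallyFinite.exists_tendsto_l1Norm_sub (hX : AnalyticallyFinite X) {ι : Type*}
    (l : Ultrafilter ι) (φ : ι → HolomorphicQuadraticDifferential X)
    (hφ : ∀ n, (φ n).l1Norm ≤ 1) : ∃ ψ : HolomorphicQuadraticDifferential X,
      Tendsto (fun n => (φ n - ψ).l1Norm) l (𝓝 0) := by
  obtain ⟨N, g, c, R, hR, hg, hcov⟩ := hX.exists_punctured_discs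
  have hφ' : ∀ n, (φ n).full.l1Norm ≤ 1 := fun n => (φ n).l1Norm_full.trans_le (hφ n)
  obtain ⟨ψ, hψ⟩ := HolomorphicQuadraticDifferential.exists_tendstoLocallyUniformlyOn l _ hφ'
  refine ⟨ψ.ofFull, ?_⟩
  have heq : ∀ n, (φ n - ψ.ofFull).l1Norm = ((φ n).full - ψ).l1Norm := fun n => by
    rw [← HolomorphicQuadraticDifferential.l1Norm_ofFull]
    exact HolomorphicQuadraticDifferential.l1Norm_congr fun e z hz =>
      congrArg (· - ψ.ofFull.coeff e z) ((φ n).fullCoeff_full hz).symm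
  simp only [heq]
  have hlim := tendsto_finsetSum (Finset.univ : Finset (Fin N)) fun i _ =>
    HolomorphicQuadraticDifferential.tendsto_lintegral_ball l hφ' (hψ (g i)) (hR i) (hg i)
  rw [Finset.sum_const_zero] at hlim
  exact tendsto_of_tendsto_of_tendsto_of_le_of_le tendsto_const_nhds hlim (fun n => zero_le)
    fun n => HolomorphicQuadraticDifferential.l1Norm_le_sum g _ (fun i => isOpen_ball) hcov _

end Compactness

/-! ### Surface integrals as integrals against a single measure -/

section CoverMeasure

variable {X : Type u} [TopologicalSpace X] [ChartedSpace ℂ X]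

/-- The measure on `ℕ × ℂ` that assembles the pieces of a chart cover. -/
def ChartCover.measure (C : ChartCover X) : Measure (ℕ × ℂ) :=
  Measure.sum fun n => (volume.restrict ((C.chart n).1 '' C.piece n)).map (Prod.mk n)

theorem ChartCover.lintegral_measure (C : ChartCover X) (ρ : Chart X → ℂ → ℝ≥0∞) :
    ∫⁻ p, ρ (C.chart p.1) p.2 ∂C.measure = C.lintegral ρ := by
  rw [ChartCover.measure, lintegral_sum_measure]
  exact tsum_congr fun n => (measurableEmbedding_prodMk_left n).lintegral_map _

theorem ChartCover.integral_measure (C : ChartCover X) {f : Chart X → ℂ → ℂ}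
    (hf : Integrable (fun p : ℕ × ℂ => f (C.chart p.1) p.2) C.measure) :
    C.integral f = ∫ p, f (C.chart p.1) p.2 ∂C.measure := by
  rw [ChartCover.measure, integral_sum_measure hf]
  exact tsum_congr fun n => ((measurableEmbedding_prodMk_left n).integral_map
    fun p : ℕ × ℂ => f (C.chart p.1) p.2).symm

theorem ChartCover.ae_measure_iff (C : ChartCover X) {P : ℕ × ℂ → Prop} :
    (∀ᵐ p ∂C.measure, P p) ↔
      ∀ n, ∀ᵐ z ∂(volume.restrict ((C.chart n).1 '' C.piece n)), P (n, z) := by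
  rw [ChartCover.measure, Measure.ae_sum_iff]
  exact forall_congr' fun n => (measurableEmbedding_prodMk_left n).ae_map_iff

theorem ChartCover.ae_measure (C : ChartCover X) {P : Chart X → ℂ → Prop}
    (h : ∀ e : Chart X, ∀ᵐ z ∂(volume.restrict e.1.target), P e z) :
    ∀ᵐ p ∂C.measure, P (C.chart p.1) p.2 :=
  C.ae_measure_iff.2 fun n =>
    ae_restrict_of_ae_restrict_of_subset (C.image_piece_subset n) (h _)

theorem ChartCover.aemeasurable (C : ChartCover X) {f : Chart X → ℂ → ℂ}
    (hf : ∀ e : Chart X, AEMeasurable (f e) (volume.restrict e.1.target)) :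
    AEMeasurable (fun p : ℕ × ℂ => f (C.chart p.1) p.2) C.measure := by
  rw [ChartCover.measure, aemeasurable_sum_measure_iff]
  exact fun n => (measurableEmbedding_prodMk_left n).aemeasurable_map_iff.2
    ((hf _).mono_measure (Measure.restrict_mono (C.image_piece_subset n) le_rfl))

theorem HolomorphicQuadraticDifferential.aestronglyMeasurable
    (φ : HolomorphicQuadraticDifferential X) (C : ChartCover X) :
    AEStronglyMeasurable (fun p : ℕ × ℂ => φ.coeff (C.chart p.1) p.2) C.measure :=
  (C.aemeasurable fun e =>
    (φ.holomorphic e).continuousOn.aemeasurable e.1.open_target.measurableSet).aestronglyMeasurable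

theorem BeltramiDifferential.aestronglyMeasurable (μ : BeltramiDifferential X) (C : ChartCover X) :
    AEStronglyMeasurable (fun p : ℕ × ℂ => μ.coeff (C.chart p.1) p.2) C.measure :=
  (C.aemeasurable μ.measurable).aestronglyMeasurable

theorem BeltramiDifferential.linftyNorm_le (μ : BeltramiDifferential X) {K : ℝ}
    (h : ∀ e : Chart X, ∀ᵐ z ∂(volume.restrict e.1.target), ‖μ.coeff e z‖ ≤ K) :
    μ.linftyNorm ≤ ENNReal.ofReal K :=
  iSup_le fun e => essSup_le_of_ae_le _ ((h e).mono fun z hz => by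
    change ‖μ.coeff e z‖ₑ ≤ ENNReal.ofReal K
    rw [← ofReal_norm]
    exact ENNReal.ofReal_le_ofReal hz)

theorem BeltramiDifferential.linftyNorm_ne_top (μ : BeltramiDifferential X) :
    μ.linftyNorm ≠ ⊤ := by
  obtain ⟨K, hK⟩ := μ.bounded
  exact ne_top_of_le_ne_top ENNReal.ofReal_ne_top (μ.linftyNorm_le hK)

theorem BeltramiDifferential.ae_norm_le (μ : BeltramiDifferential X) (e : Chart X) :
    ∀ᵐ z ∂(volume.restrict e.1.target), ‖μ.coeff e z‖ ≤ μ.linftyNorm.toReal := by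
  filter_upwards [ENNReal.ae_le_essSup fun z => ‖μ.coeff e z‖ₑ] with z hz
  rw [← toReal_enorm]
  exact ENNReal.toReal_mono μ.linftyNorm_ne_top
    (hz.trans (le_iSup (fun e : Chart X =>
      essSup (fun z => ‖μ.coeff e z‖ₑ) (volume.restrict e.1.target)) e))

theorem BeltramiDifferential.EqTeichmuller.linftyNorm_le {μ : BeltramiDifferential X}
    {ψ : HolomorphicQuadraticDifferential X} {c : ℝ} (hc : 0 ≤ c)
    (h : μ.EqTeichmuller c ψ) : μ.linftyNorm.toReal ≤ c := by
  refine ENNReal.toReal_le_of_le_ofReal hc (μ.linftyNorm_le fun e => (h e).mono fun z hz => ?_)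
  rw [hz, norm_mul, norm_div, RCLike.norm_conj, Complex.norm_real, Complex.norm_real, norm_norm,
    Real.norm_of_nonneg hc]
  -- At a zero of `ψ` the quotient is `0 / 0 = 0`, so only an inequality holds pointwise.
  exact mul_le_of_le_one_right hc (div_self_le_one _)

end CoverMeasure

/-! ### The norm and the pairing: linearity and the trivial bound -/

section Pairing

variable {X : Type u} [TopologicalSpace X] [ChartedSpace ℂ X] [IsManifold 𝓘(ℂ) ω X]
  [SecondCountableTopology X] [Nonempty X]

namespace HolomorphicQuadraticDifferential

theorem lintegral_measure (φ : HolomorphicQuadraticDifferential X) (C : ChartCover X) :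
    ∫⁻ p, ‖φ.coeff (C.chart p.1) p.2‖ₑ ∂C.measure = φ.l1Norm := by
  rw [l1Norm_eq φ C]
  exact C.lintegral_measure fun e z => ‖φ.coeff e z‖ₑ

theorem integrable {φ : HolomorphicQuadraticDifferential X} (hφ : φ ∈ A2 X) (C : ChartCover X) :
    Integrable (fun p : ℕ × ℂ => φ.coeff (C.chart p.1) p.2) C.measure :=
  ⟨φ.aestronglyMeasurable C, (φ.lintegral_measure C).trans_lt hφ⟩

theorem integral_norm (φ : HolomorphicQuadraticDifferential X) (C : ChartCover X) :
    ∫ p, ‖φ.coeff (C.chart p.1) p.2‖ ∂C.measure = φ.l1Norm.toReal := by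
  rw [integral_norm_eq_lintegral_enorm (φ.aestronglyMeasurable C), φ.lintegral_measure C]

theorem l1Norm_smul (a : ℂ) (φ : HolomorphicQuadraticDifferential X) :
    (a • φ).l1Norm = ‖a‖ₑ * φ.l1Norm := by
  obtain ⟨C⟩ := ChartCover.nonempty (X := X)
  rw [← φ.lintegral_measure C, ← (a • φ).lintegral_measure C,
    ← lintegral_const_mul' _ _ enorm_ne_top]
  simp only [smul_coeff, enorm_mul]

theorem l1Norm_le_add_sub (φ ψ : HolomorphicQuadraticDifferential X) :
    φ.l1Norm ≤ ψ.l1Norm + (φ - ψ).l1Norm := by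
  obtain ⟨C⟩ := ChartCover.nonempty (X := X)
  rw [← φ.lintegral_measure C, ← ψ.lintegral_measure C, ← (φ - ψ).lintegral_measure C,
    ← lintegral_add_left' (ψ.aestronglyMeasurable C).enorm]
  refine lintegral_mono fun p => ?_
  calc ‖φ.coeff (C.chart p.1) p.2‖ₑ
      = ‖ψ.coeff (C.chart p.1) p.2 + (φ - ψ).coeff (C.chart p.1) p.2‖ₑ := by
        rw [sub_coeff, add_sub_cancel]
    _ ≤ _ := enorm_add_le _ _

theorem l1Norm_sub_comm (φ ψ : HolomorphicQuadraticDifferential X) :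
    (φ - ψ).l1Norm = (ψ - φ).l1Norm := by
  obtain ⟨C⟩ := ChartCover.nonempty (X := X)
  rw [← (φ - ψ).lintegral_measure C, ← (ψ - φ).lintegral_measure C]
  simp only [sub_coeff, enorm_sub_rev]

theorem nonzero_of_l1Norm_ne_zero {φ : HolomorphicQuadraticDifferential X}
    (h : φ.l1Norm ≠ 0) : φ.Nonzero := by
  by_contra hn
  simp only [Nonzero, not_exists, not_and, not_not] at hn
  have : φ.l1Norm = ((0 : ℂ) • φ).l1Norm := l1Norm_congr fun e z hz => by
    rw [hn e z hz, smul_coeff, zero_mul]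
  rw [l1Norm_smul, enorm_zero, zero_mul] at this
  exact h this

end HolomorphicQuadraticDifferential

theorem integrable_mul (μ : BeltramiDifferential X) {φ : HolomorphicQuadraticDifferential X}
    (hφ : φ ∈ A2 X) (C : ChartCover X) :
    Integrable (fun p : ℕ × ℂ => μ.coeff (C.chart p.1) p.2 * φ.coeff (C.chart p.1) p.2)
      C.measure :=
  (HolomorphicQuadraticDifferential.integrable hφ C).bdd_mul (μ.aestronglyMeasurable C)
    (C.ae_measure μ.ae_norm_le)

theorem pairing_eq_integral (μ : BeltramiDifferential X) {φ : HolomorphicQuadraticDifferential X}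
    (hφ : φ ∈ A2 X) (C : ChartCover X) :
    pairing μ φ = ∫ p, μ.coeff (C.chart p.1) p.2 * φ.coeff (C.chart p.1) p.2 ∂C.measure := by
  rw [pairing_eq μ φ hφ C]
  exact C.integral_measure (integrable_mul μ hφ C)

theorem norm_pairing_le (μ : BeltramiDifferential X) {φ : HolomorphicQuadraticDifferential X}
    (hφ : φ ∈ A2 X) : ‖pairing μ φ‖ ≤ μ.linftyNorm.toReal * φ.l1Norm.toReal := by
  obtain ⟨C⟩ := ChartCover.nonempty (X := X)
  rw [pairing_eq_integral μ hφ C, ← φ.integral_norm C, ← integral_const_mul]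
  refine norm_integral_le_of_norm_le
    ((HolomorphicQuadraticDifferential.integrable hφ C).norm.const_mul _) ?_
  filter_upwards [C.ae_measure μ.ae_norm_le] with p hp
  rw [norm_mul]
  gcongr

theorem pairing_smul (μ : BeltramiDifferential X) {φ : HolomorphicQuadraticDifferential X}
    (hφ : φ ∈ A2 X) (a : ℂ) : pairing μ (a • φ) = a * pairing μ φ := by
  obtain ⟨C⟩ := ChartCover.nonempty (X := X)
  have ha : a • φ ∈ A2 X := by
    rw [A2, mem_ofPred_eq, HolomorphicQuadraticDifferential.l1Norm_smul]
    exact ENNReal.mul_lt_top enorm_lt_top hφ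
  rw [pairing_eq_integral μ hφ C, pairing_eq_integral μ ha C, ← integral_const_mul]
  refine integral_congr_ae (Eventually.of_forall fun p => ?_)
  simp only [HolomorphicQuadraticDifferential.smul_coeff]
  ring

theorem pairing_sub (μ : BeltramiDifferential X) {φ ψ : HolomorphicQuadraticDifferential X}
    (hφ : φ ∈ A2 X) (hψ : ψ ∈ A2 X) (hs : φ - ψ ∈ A2 X) :
    pairing μ (φ - ψ) = pairing μ φ - pairing μ ψ := by
  obtain ⟨C⟩ := ChartCover.nonempty (X := X)
  rw [pairing_eq_integral μ hφ C, pairing_eq_integral μ hψ C, pairing_eq_integral μ hs C,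
    ← integral_sub (integrable_mul μ hφ C) (integrable_mul μ hψ C)]
  simp only [HolomorphicQuadraticDifferential.sub_coeff, mul_sub]

end Pairing

/-! ### Zeros of quadratic differentials -/

section Zeros

variable {X : Type u} [TopologicalSpace X] [ChartedSpace ℂ X] [IsManifold 𝓘(ℂ) ω X]

namespace HolomorphicQuadraticDifferential

theorem eventually_eq_zero_of_chart (ψ : HolomorphicQuadraticDifferential X) {e e' : Chart X}
    {x : X} (hx : x ∈ e.1.source) (hx' : x ∈ e'.1.source)
    (h : ∀ᶠ z in 𝓝 (e'.1 x), ψ.coeff e' z = 0) : ∀ᶠ z in 𝓝 (e.1 x), ψ.coeff e z = 0 := by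
  have hz : e.1 x ∈ overlap e e' := ⟨e.1.map_source hx, by rwa [e.1.left_inv hx]⟩
  have ht : Tendsto (trans e e') (𝓝 (e.1 x)) (𝓝 (e'.1 x)) := by
    have := (differentiableAt_trans hz).continuousAt.tendsto
    rwa [trans, e.1.left_inv hx] at this
  filter_upwards [ht.eventually h, (isOpen_overlap e e').mem_nhds hz] with z h0 hzo
  rw [ψ.transform e e' z hzo, h0, zero_mul]

/-- The zeros of a nonzero quadratic differential on a connected surface are isolated. -/
theorem Nonzero.eventually_ne_zero [ConnectedSpace X] {ψ : HolomorphicQuadraticDifferential X}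
    (hψ : ψ.Nonzero) (e : Chart X) {z : ℂ} (hz : z ∈ e.1.target) :
    ∀ᶠ w in 𝓝[≠] z, ψ.coeff e w ≠ 0 := by
  have han : ∀ (e : Chart X), ∀ z ∈ e.1.target,
      (∀ᶠ w in 𝓝 z, ψ.coeff e w = 0) ∨ ∀ᶠ w in 𝓝[≠] z, ψ.coeff e w ≠ 0 := fun e z hz =>
    ((ψ.holomorphic e).analyticAt
      (e.1.open_target.mem_nhds hz)).eventually_eq_zero_or_eventually_ne_zero
  -- The points near which `ψ` vanishes form an open and closed set; by connectedness it is empty or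
  -- everything, and the latter contradicts `ψ ≠ 0`.
  set V : Set X := {x | ∃ e : Chart X, x ∈ e.1.source ∧ ∀ᶠ z in 𝓝 (e.1 x), ψ.coeff e z = 0}
    with hV
  have hVo : IsOpen V := by
    have : V = ⋃ e : Chart X, e.1.source ∩ e.1 ⁻¹' {z | ∀ᶠ w in 𝓝 z, ψ.coeff e w = 0} := by
      ext x
      simp [hV]
    rw [this]
    exact isOpen_iUnion fun e => e.1.isOpen_inter_preimage isOpen_setOfPred_eventually_nhds
  have hVc : IsClosed V := by
    refine isClosed_of_closure_subset fun x hx => ?_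
    let e : Chart X := ⟨chartAt ℂ x, chart_mem_atlas ℂ x⟩
    have hxe : x ∈ e.1.source := mem_chart_source ℂ x
    refine (han e (e.1 x) (e.1.map_source hxe)).elim (fun h => ⟨e, hxe, h⟩) fun h => ?_
    exfalso
    have h' := eventually_eventually_nhdsWithin.2 h
    rw [eventually_nhdsWithin_iff] at h h'
    obtain ⟨y, ⟨hye, hy⟩, e', hye', hy'⟩ := mem_closure_iff_nhds.1 hx _
      (inter_mem (e.1.open_source.mem_nhds hxe)
        ((e.1.continuousAt hxe).eventually (eventually_eventually_nhds.2 h)))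
    have h0 := ψ.eventually_eq_zero_of_chart hye hye' hy'
    have hy : ∀ᶠ w in 𝓝 (e.1 y), w ∈ ({e.1 x} : Set ℂ)ᶜ → ψ.coeff e w ≠ 0 := hy
    -- Near `y` the differential both vanishes and is nonzero away from `x`, so a neighborhood of
    -- `e.1 y` would be the single point `e.1 x`. But points of the plane are not open.
    have h1 : ∀ᶠ w in 𝓝 (e.1 y), w = e.1 x := by
      filter_upwards [h0, hy] with w hw0 hw
      by_contra hne
      exact hw hne hw0
    have h2 : ({e.1 x} : Set ℂ) ∈ 𝓝 (e.1 y) := h1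
    have h3 : e.1 y = e.1 x := by simpa using mem_of_mem_nhds h2
    rw [h3] at h2
    exact not_isOpen_singleton (e.1 x) (isOpen_singleton_iff_nhds_eq_pure _ |>.2
      (le_antisymm (le_pure_iff.2 h2) (pure_le_nhds _)))
  rcases isClopen_iff.1 ⟨hVc, hVo⟩ with h | h
  · refine (han e z hz).resolve_left fun h0 => ?_
    have : e.1.symm z ∈ V := ⟨e, e.1.map_target hz, by rwa [e.1.right_inv hz]⟩
    rw [h] at this
    exact this
  · obtain ⟨e', w, hw, hne⟩ := hψ
    obtain ⟨e'', hs, h0⟩ : e'.1.symm w ∈ V := h ▸ mem_univ _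
    have := (ψ.eventually_eq_zero_of_chart (e'.1.map_target hw) hs h0).self_of_nhds
    rw [e'.1.right_inv hw] at this
    exact absurd this hne

theorem Nonzero.ae_ne_zero [ConnectedSpace X] {ψ : HolomorphicQuadraticDifferential X}
    (hψ : ψ.Nonzero) (e : Chart X) :
    ∀ᵐ z ∂(volume.restrict e.1.target), ψ.coeff e z ≠ 0 := by
  rw [ae_restrict_iff' e.1.open_target.measurableSet, ae_iff]
  refine measure_null_of_locally_null _ fun z hz => ?_
  simp only [mem_ofPred_eq, not_forall, not_not] at hz
  -- Near each of its points the zero set is a single point, hence locally null.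
  refine ⟨{z}, ?_, measure_singleton z⟩
  have h := eventually_nhdsWithin_iff.1 (hψ.eventually_ne_zero e hz.1)
  filter_upwards [nhdsWithin_le_nhds h, self_mem_nhdsWithin] with w hw hws
  simp only [not_forall, not_not] at hws
  by_contra hne
  exact hw hne hws.2

theorem Nonzero.l1Norm_ne_zero [ConnectedSpace X] [SecondCountableTopology X]
    {ψ : HolomorphicQuadraticDifferential X} (hψ : ψ.Nonzero) : ψ.l1Norm ≠ 0 := by
  intro h0
  obtain ⟨e, z, hz, -⟩ := id hψ
  have h1 : ∫⁻ z in e.1.target, ‖ψ.coeff e z‖ₑ = 0 :=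
    le_antisymm ((ψ.lintegral_target_le e).trans h0.le) zero_le
  rw [lintegral_eq_zero_iff' ((ψ.holomorphic e).continuousOn.aemeasurable
    e.1.open_target.measurableSet).enorm] at h1
  have h2 : ∀ᵐ z ∂(volume.restrict e.1.target), False := by
    filter_upwards [h1, hψ.ae_ne_zero e] with w hw hne
    exact hne (by simpa using hw)
  have h3 : volume e.1.target = 0 := by
    simpa [ae_iff] using h2
  exact e.1.open_target.measure_ne_zero volume ⟨z, hz⟩ h3

end HolomorphicQuadraticDifferential

end Zeros

/-! ### Extremality and Teichmüller differentials -/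

section Extremality

variable {X : Type u} [TopologicalSpace X] [ChartedSpace ℂ X] [IsManifold 𝓘(ℂ) ω X]
  [ConnectedSpace X] [SecondCountableTopology X]

theorem eq_ofReal_of_norm_le_re {w : ℂ} {t : ℝ} (h : ‖w‖ ≤ t) (hre : w.re = t) : w = t := by
  have h1 : w.re = ‖w‖ := le_antisymm (Complex.re_le_norm w) (h.trans hre.ge)
  have h2 := Complex.re_eq_norm.1 h1
  exact Complex.ext (by simpa using hre) (by simpa using h2.2.symm)

/-- Equality in `|∫ μψ| ≤ ‖μ‖_∞ ‖ψ‖₁` forces `μ` to be a Teichmüller differential. -/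
theorem BeltramiDifferential.eqTeichmuller_of_pairing_eq {μ : BeltramiDifferential X}
    {ψ : HolomorphicQuadraticDifferential X} (hψ : ψ ∈ A2 X) (hne : ψ.Nonzero)
    (h : pairing μ ψ = (μ.linftyNorm.toReal * ψ.l1Norm.toReal : ℝ)) :
    μ.EqTeichmuller μ.linftyNorm.toReal ψ := by
  intro e
  obtain ⟨C₀⟩ := ChartCover.nonempty (X := X)
  -- With `e` as the first chart, an almost everywhere statement for `C.measure` includes one on the
  -- whole domain of `e`.
  set C := C₀.cons e with hC
  set M := μ.linftyNorm.toReal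
  have hbound : ∀ᵐ p ∂C.measure,
      ‖μ.coeff (C.chart p.1) p.2 * ψ.coeff (C.chart p.1) p.2‖ ≤
        M * ‖ψ.coeff (C.chart p.1) p.2‖ := by
    filter_upwards [C.ae_measure μ.ae_norm_le] with p hp
    rw [norm_mul]
    gcongr
  have hi1 := (HolomorphicQuadraticDifferential.integrable hψ C).norm.const_mul M
  have hi2 := integrable_mul μ hψ C
  have hi3 : Integrable (fun p : ℕ × ℂ =>
      (μ.coeff (C.chart p.1) p.2 * ψ.coeff (C.chart p.1) p.2).re) C.measure := hi2.re
  -- The integrand is nonnegative and has integral zero, so `Re(μψ) = M|ψ|` almost everywhere.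
  -- Together with `|μψ| ≤ M|ψ|` this gives `μψ = M|ψ|`.
  have hint : ∫ p, (M * ‖ψ.coeff (C.chart p.1) p.2‖ -
      (μ.coeff (C.chart p.1) p.2 * ψ.coeff (C.chart p.1) p.2).re) ∂C.measure = 0 := by
    have hre : ∫ p, (μ.coeff (C.chart p.1) p.2 * ψ.coeff (C.chart p.1) p.2).re ∂C.measure =
        (pairing μ ψ).re := by
      rw [pairing_eq_integral μ hψ C]
      exact integral_re hi2
    rw [integral_sub hi1 hi3, integral_const_mul, ψ.integral_norm C]
    refine sub_eq_zero.2 ?_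
    refine Eq.trans ?_ hre.symm
    rw [h, Complex.ofReal_re]
  have hnonneg : 0 ≤ᵐ[C.measure] fun p : ℕ × ℂ => M * ‖ψ.coeff (C.chart p.1) p.2‖ -
      (μ.coeff (C.chart p.1) p.2 * ψ.coeff (C.chart p.1) p.2).re := by
    filter_upwards [hbound] with p hp
    exact sub_nonneg.2 ((Complex.re_le_norm _).trans hp)
  have hzero := (integral_eq_zero_iff_of_nonneg_ae hnonneg (hi1.sub hi3)).1 hint
  have hall : ∀ᵐ p ∂C.measure, μ.coeff (C.chart p.1) p.2 =
      M * (starRingEnd ℂ (ψ.coeff (C.chart p.1) p.2) / ‖ψ.coeff (C.chart p.1) p.2‖) := by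
    filter_upwards [hzero, hbound, C.ae_measure hne.ae_ne_zero] with p hp hb h0
    have hw := eq_ofReal_of_norm_le_re hb (sub_eq_zero.1 hp).symm
    have hn : (‖ψ.coeff (C.chart p.1) p.2‖ : ℂ) ≠ 0 := by simpa using h0
    refine mul_right_cancel₀ h0 ?_
    rw [hw, mul_assoc, div_mul_eq_mul_div, mul_comm (starRingEnd ℂ _), Complex.mul_conj,
      Complex.normSq_eq_norm_sq]
    push_cast
    field_simp
  have := C.ae_measure_iff.1 hall 0
  rwa [hC, C₀.image_piece_cons_zero e] at this

/-- Pointwise `(ψ̄/|ψ|) ψ = |ψ|`, also at the zeros of `ψ`, where both sides are `0`. -/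
theorem BeltramiDifferential.EqTeichmuller.pairing_eq {μ : BeltramiDifferential X}
    {ψ : HolomorphicQuadraticDifferential X} {c : ℝ} (hψ : ψ ∈ A2 X)
    (h : μ.EqTeichmuller c ψ) : pairing μ ψ = (c * ψ.l1Norm.toReal : ℝ) := by
  obtain ⟨C⟩ := ChartCover.nonempty (X := X)
  rw [pairing_eq_integral μ hψ C, ← ψ.integral_norm C, ← integral_const_mul,
    ← integral_complex_ofReal]
  refine integral_congr_ae ?_
  filter_upwards [C.ae_measure h] with p hp
  rw [hp]
  by_cases h0 : ψ.coeff (C.chart p.1) p.2 = 0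
  · simp [h0]
  · have hn : (‖ψ.coeff (C.chart p.1) p.2‖ : ℂ) ≠ 0 := by simpa using h0
    rw [mul_assoc, div_mul_eq_mul_div, mul_comm (starRingEnd ℂ _), Complex.mul_conj,
      Complex.normSq_eq_norm_sq]
    push_cast
    field_simp

/-- A Teichmüller differential is infinitesimally extremal. -/
theorem BeltramiDifferential.EqTeichmuller.infinitesimallyExtremal {μ : BeltramiDifferential X}
    {ψ : HolomorphicQuadraticDifferential X} {c : ℝ} (hψ : ψ ∈ A2 X) (hne : ψ.Nonzero)
    (hc : 0 ≤ c) (h : μ.EqTeichmuller c ψ) (φ₀ : HolomorphicQuadraticDifferential X) :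
    InfinitesimallyExtremal φ₀ μ := by
  have ht : 0 < ψ.l1Norm.toReal := ENNReal.toReal_pos hne.l1Norm_ne_zero hψ.ne
  have hp := h.pairing_eq hψ
  have hcM : c ≤ μ.linftyNorm.toReal := by
    have := norm_pairing_le μ hψ
    rw [hp, Complex.norm_real, Real.norm_of_nonneg (by positivity)] at this
    exact le_of_mul_le_mul_right this ht
  have hMc : μ.linftyNorm.toReal = c := le_antisymm (h.linftyNorm_le hc) hcM
  refine le_antisymm (sSup_le ?_) (le_sSup ?_)
  · rintro _ ⟨φ, hφ, h1, rfl⟩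
    have := norm_pairing_le μ hφ
    rw [h1, ENNReal.toReal_one, mul_one] at this
    exact EReal.coe_le_coe_iff.2 (by linarith)
  · set a : ℂ := ((ψ.l1Norm.toReal⁻¹ : ℝ) : ℂ)
    have h1 : (a • ψ).l1Norm = 1 := by
      rw [HolomorphicQuadraticDifferential.l1Norm_smul, ← ofReal_norm, Complex.norm_real,
        Real.norm_of_nonneg (by positivity), ENNReal.ofReal_inv_of_pos ht,
        ENNReal.ofReal_toReal hψ.ne, ENNReal.inv_mul_cancel hne.l1Norm_ne_zero hψ.ne]
    refine ⟨a • ψ, h1.trans_lt ENNReal.one_lt_top, h1, ?_⟩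
    have h2 : pairing μ (a • ψ) = (c : ℂ) := by
      rw [pairing_smul μ hψ, hp, ← Complex.ofReal_mul]
      congr 1
      field_simp
    rw [h2, Complex.norm_real, Real.norm_of_nonneg hc, hMc]

/-- On an analytically finite surface the supremum defining `β(μ, φ₀)` is attained for extremal
`μ`. -/
theorem InfinitesimallyExtremal.exists_pairing_eq (hX : AnalyticallyFinite X)
    {φ₀ : HolomorphicQuadraticDifferential X} {μ : BeltramiDifferential X}
    (h : InfinitesimallyExtremal φ₀ μ) : ∃ ψ : HolomorphicQuadraticDifferential X,
      ψ.l1Norm = 1 ∧ pairing μ ψ = (μ.linftyNorm.toReal : ℝ) := by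
  set M := μ.linftyNorm.toReal
  have hseq : ∀ n : ℕ, ∃ φ ∈ A2 X, φ.l1Norm = 1 ∧ M - 1 / ((n : ℝ) + 1) ≤ ‖pairing μ φ‖ := by
    intro n
    -- Extremality makes the supremum a real number, so it is not over the empty set. The `φ₀` term
    -- then cancels, leaving a maximizing sequence for `|∫ μφ|`.
    have hlt : ((M + (pairing μ φ₀).re - 1 / ((n : ℝ) + 1) : ℝ) : EReal) < beta μ φ₀ := by
      rw [h, EReal.coe_lt_coe_iff]
      have : (0 : ℝ) < 1 / ((n : ℝ) + 1) := by positivity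
      linarith
    obtain ⟨_, ⟨φ, hφ, h1, rfl⟩, hφn⟩ := lt_sSup_iff.1 hlt
    rw [EReal.coe_lt_coe_iff] at hφn
    exact ⟨φ, hφ, h1, by linarith⟩
  choose φ hφ h1 hφn using hseq
  -- The ultrafilter is nonprincipal and so refines `atTop`; the errors `1/(n + 1)` tend to zero
  -- along it.
  obtain ⟨ψ, hψ⟩ := hX.exists_tendsto_l1Norm_sub (hyperfilter ℕ) φ fun n => (h1 n).le
  have hψ1 : ψ.l1Norm = 1 := by
    refine le_antisymm ?_ ?_
    · refine ge_of_tendsto' (f := fun n => 1 + (φ n - ψ).l1Norm)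
        (by simpa using hψ.const_add 1) fun n => ?_
      rw [← h1 n, HolomorphicQuadraticDifferential.l1Norm_sub_comm]
      exact ψ.l1Norm_le_add_sub (φ n)
    · refine ge_of_tendsto' (f := fun n => ψ.l1Norm + (φ n - ψ).l1Norm)
        (by simpa using hψ.const_add ψ.l1Norm) fun n => ?_
      rw [← h1 n]
      exact (φ n).l1Norm_le_add_sub ψ
  have hψA : ψ ∈ A2 X := hψ1.trans_lt ENNReal.one_lt_top
  have hM : M ≤ ‖pairing μ ψ‖ := by
    have hd : Tendsto (fun n => (φ n - ψ).l1Norm.toReal) (hyperfilter ℕ) (𝓝 0) := by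
      simpa [Function.comp_def] using (ENNReal.tendsto_toReal ENNReal.zero_ne_top).comp hψ
    have hn : Tendsto (fun n : ℕ => 1 / ((n : ℝ) + 1)) (hyperfilter ℕ) (𝓝 0) :=
      tendsto_one_div_add_atTop_nhds_zero_nat.mono_left Nat.hyperfilter_le_atTop
    have hlim : Tendsto (fun n => ‖pairing μ ψ‖ + M * (φ n - ψ).l1Norm.toReal +
        1 / ((n : ℝ) + 1)) (hyperfilter ℕ) (𝓝 ‖pairing μ ψ‖) := by
      simpa using ((hd.const_mul M).const_add ‖pairing μ ψ‖).add hn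
    -- Continuity of the pairing: `M - 1/(n + 1) ≤ |∫ μ φ n| ≤ |∫ μψ| + M ‖φ n - ψ‖₁`.
    refine ge_of_tendsto hlim ?_
    filter_upwards [hψ.eventually (gt_mem_nhds ENNReal.zero_lt_top)] with n hfin
    have h2 := norm_pairing_le μ (φ := φ n - ψ) hfin
    rw [pairing_sub μ (hφ n) hψA hfin] at h2
    have h3 := norm_le_norm_add_norm_sub' (pairing μ (φ n)) (pairing μ ψ)
    linarith [hφn n]
  have hM' : ‖pairing μ ψ‖ = M := by
    refine le_antisymm ?_ hM
    simpa [hψ1] using norm_pairing_le μ hψA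
  -- A unimodular factor makes the pairing real and nonnegative without changing the norm of `ψ`.
  obtain ⟨a, ha, haP⟩ := RCLike.exists_norm_eq_mul_self (pairing μ ψ)
  refine ⟨a • ψ, ?_, ?_⟩
  · rw [HolomorphicQuadraticDifferential.l1Norm_smul, hψ1, ← ofReal_norm, ha]
    simp
  · rw [pairing_smul μ hψA, ← haP, hM']
    rfl

end Extremality

end Riemann

end

open Riemann
theorem mainTheorem7 (X : Type u) [TopologicalSpace X] [ChartedSpace ℂ X]
    [IsManifold 𝓘(ℂ) ω X] [T2Space X] [ConnectedSpace X] [SecondCountableTopology X]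
    (hX : AnalyticallyFinite X)
    (φ₀ : HolomorphicQuadraticDifferential X) (hφ₀ : φ₀ ∈ A2 X)
    (μ : BeltramiDifferential X) :
    InfinitesimallyExtremal φ₀ μ ↔
      ∃ ψ ∈ A2 X, ψ.Nonzero ∧ ∃ c : ℝ, 0 ≤ c ∧ μ.EqTeichmuller c ψ := by
  constructor
  · intro h
    obtain ⟨ψ, h1, hp⟩ := h.exists_pairing_eq hX
    have hψ : ψ ∈ A2 X := h1.trans_lt ENNReal.one_lt_top
    have hne : ψ.Nonzero :=
      HolomorphicQuadraticDifferential.nonzero_of_l1Norm_ne_zero (by simp [h1])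
    refine ⟨ψ, hψ, hne, μ.linftyNorm.toReal, ENNReal.toReal_nonneg,
      BeltramiDifferential.eqTeichmuller_of_pairing_eq hψ hne ?_⟩
    rw [hp, h1, ENNReal.toReal_one, mul_one]
  · rintro ⟨ψ, hψ, hne, c, hc, h⟩
    exact h.infinitesimallyExtremal hψ hne hc φ₀
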